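/- Let $d\in\mathbb N$, let $X\sim\mathcal N(0,I_d)$, and let $\varphi:\mathbb R^d\to\mathbb R$ be a measurable function such that $\mathbb E[\varphi(X)^2 e^{-\theta\cdot X}]<\infty$ for every $\theta\in\mathbb R^d$ and $\mathbb P(\varphi(X)\neq 0)>0$. Define $$v(\theta)=\mathbb E\big[\varphi(X)^2 e^{-\theta\cdot X+|\theta|^2/2}\big],\qquad \theta\in\mathbb R^d .$$ Let $(X_i)_{i\ge1}$ and $(\bar X_i)_{i\ge1}$ be two independent sequences of i.i.d. $\mathcal N(0,I_d)$ random vectors. For each $n$ let $\theta_n$ be a $\sigma(X_1,\dots,X_n)$-measurable random vector which almost surely minimizes $$v_n(\theta)=\frac1n\sum_{i=1}^n\varphi(X_i)^2e^{-\theta\cdot X_i+|\theta|^2/2},$$ and put $$M_m(\theta)=\frac1m\sum_{i=1}^m\varphi(\bar X_i+\theta)e^{-\theta\cdot\bar X_i-|\theta|^2/2}.$$ Let $m\mapsto n(m)\in\mathbb N$ be nondecreasing with $n(m)\to\infty$ as $m\to\infty$. Then: (i) For every $m\ge1$, $M_m(\theta_{n(m)})$ is integrable with $\mathbb E[M_m(\theta_{n(m)})]=\mathbb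 E[\varphi(X)]$, and $M_m(\theta_{n(m)})\to\mathbb E[\varphi(X)]$ almost surely as $m\to\infty$. (ii) The function $v$ has a unique minimizer $\theta^\star$. If moreover $\varphi$ is continuous at Lebesgue-almost every point and, for some $\eta>0$ and some compact neighbourhood $\mathcal V$ of $\theta^\star$, $\sup_{\theta\in\mathcal V}\mathbb E\big[|\varphi(X+\theta)|^{2+\eta}\big]<\infty$, then $\varphi(X+\theta^\star)e^{-\theta^\star\cdot X-|\theta^\star|^2/2}$ is square integrable and $$\sqrt m\,\big(M_m(\theta_{n(m)})-\mathbb E[\varphi(X)]\big)\xrightarrow[m\to\infty]{\mathcal L}\mathcal N\big(0,(\sigma^\star)^2\big),$$ where $$(\sigma^\star)^2=\mathrm{Var}\Big(\varphi(X+\theta^\star)e^{-\theta^\star\cdot X-|\theta^\star|^2/2}\Big)=v(\theta^\star)-\mathbb E[\varphi(X)]^2 .$$ -/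

import Mathlib

open MeasureTheory ProbabilityTheory Filter Topology
open scoped ENNReal NNReal RealInnerProductSpace

noncomputable section

namespace AdaptiveIS

/-- `ℝ^d` with its Euclidean norm and inner product. -/
abbrev Vec (d : ℕ) := EuclideanSpace ℝ (Fin d)

/-- The standard Gaussian law `N(0, I_d)` on `ℝ^d`. -/
abbrev gauss (d : ℕ) : Measure (Vec d) := stdGaussian (Vec d)

variable {d : ℕ}

/-- The mean-shifted importance sampling integrand
`x ↦ φ(x + θ) exp(-θ·x - |θ|²/2)`. -/
def shifted (φ : Vec d → ℝ) (θ x : Vec d) : ℝ :=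
  φ (x + θ) * Real.exp (-⟪θ, x⟫ - ‖θ‖ ^ 2 / 2)

/-- The function `φ(x)² exp(-θ·x + |θ|²/2)` averaged by the variance criterion. -/
def criterion (φ : Vec d → ℝ) (θ x : Vec d) : ℝ :=
  φ x ^ 2 * Real.exp (-⟪θ, x⟫ + ‖θ‖ ^ 2 / 2)

/-- The second moment `v(θ) = E[φ(X)² exp(-θ·X + |θ|²/2)]`, for `X ∼ N(0, I_d)`. -/
def v (φ : Vec d → ℝ) (θ : Vec d) : ℝ :=
  ∫ x, criterion φ θ x ∂(gauss d)

/-- The empirical criterion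
`v_n(θ) = (1/n) ∑_{i ≤ n} φ(x_i)² exp(-θ·x_i + |θ|²/2)` of the first `n` points of a sample. -/
def vEmp (φ : Vec d → ℝ) (x : ℕ → Vec d) (n : ℕ) (θ : Vec d) : ℝ :=
  (1 / (n : ℝ)) * ∑ i ∈ Finset.range n, criterion φ θ (x i)

/-- The importance sampling estimator
`M_m(θ) = (1/m) ∑_{i ≤ m} φ(y_i + θ) exp(-θ·y_i - |θ|²/2)` built on the first `m` points
of a sample. -/
def estimator (φ : Vec d → ℝ) (y : ℕ → Vec d) (m : ℕ) (θ : Vec d) : ℝ :=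
  (1 / (m : ℝ)) * ∑ i ∈ Finset.range m, shifted φ θ (y i)

/-- The `σ`-algebra generated by the first `n` variables of a sequence. -/
abbrev sampleSigma {Ω : Type*} (X : ℕ → Ω → Vec d) (n : ℕ) : MeasurableSpace Ω :=
  ⨆ i ∈ Finset.range n, MeasurableSpace.comap (X i) inferInstance

end AdaptiveIS

end

/-! The two samples are independent, so Fubini allows freezing `X`: almost every realization of the
parameters is a deterministic sequence converging to the minimizer of `v`. It then suffices to study
the estimator along deterministic convergent parameters (`ae_of_ae_ae_of_indepFun`,
`integral_eq_integral_integral_of_indepFun`).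

Consistency of the minimizers rests on one convexity inequality, `criterion_lower_bound`, obtained
from `1 + u ≤ exp u`. Integrated, it gives coercivity and strict minimality; averaged over the
sample, it bounds the distance from an empirical minimizer to the optimum by the empirical score at
that optimum. The strong law at this single point then suffices, without any uniform law of large
numbers.

For frozen parameters the summands form a triangular array whose common law changes with `m`. The
strong law `ae_tendsto_average_sub_integral` combines truncation at level `m`, fourth moments and
Borel–Cantelli. Its summability condition and the central limit theorem both use Cameron–Martin to
undo the translation: the parameter leaves the argument of `φ` and survives only in smooth
exponential factors, with a common integrable envelope. Dominated convergence then yields the limit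
of the characteristic functions for measurable `φ`. -/

namespace AdaptiveIS

/-! ### Exponential moments and translations of the standard Gaussian law. -/

section Gaussian

variable {d : ℕ}

lemma map_inner_gauss (t : Vec d) :
    (gauss d).map (fun x => ⟪t, x⟫) = gaussianReal 0 (‖t‖ ^ 2).toNNReal := by
  have h := IsGaussian.map_eq_gaussianReal (μ := gauss d) (innerSL ℝ t)
  rw [integral_strongDual_stdGaussian, variance_dual_stdGaussian, innerSL_apply_norm] at h
  exact h

lemma integrable_exp_inner (t : Vec d) : Integrable (fun x => Real.exp ⟪t, x⟫) (gauss d) := by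
  have h := integrable_exp_mul_gaussianReal (μ := 0) (v := (‖t‖ ^ 2).toNNReal) 1
  rw [← map_inner_gauss t] at h
  simpa [Function.comp_def] using (integrable_map_measure (by fun_prop) (by fun_prop)).1 h

lemma integral_exp_inner (t : Vec d) :
    ∫ x, Real.exp ⟪t, x⟫ ∂(gauss d) = Real.exp (‖t‖ ^ 2 / 2) := by
  have h := mgf_gaussianReal (map_inner_gauss t) 1
  simpa [mgf, Real.coe_toNNReal _ (sq_nonneg ‖t‖)] using h

/-- The density of `N(θ, I_d)` with respect to `N(0, I_d)`. -/
noncomputable def shiftDensity (θ x : Vec d) : ℝ := Real.exp (⟪θ, x⟫ - ‖θ‖ ^ 2 / 2)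

lemma shiftDensity_pos (θ x : Vec d) : 0 < shiftDensity θ x := Real.exp_pos _

lemma integrable_shiftDensity (θ : Vec d) : Integrable (shiftDensity θ) (gauss d) := by
  unfold shiftDensity
  simp_rw [Real.exp_sub, div_eq_mul_inv]
  exact (integrable_exp_inner θ).mul_const _

lemma measurable_shiftDensity (θ : Vec d) : Measurable (shiftDensity θ) := by
  unfold shiftDensity; fun_prop

lemma integral_shiftDensity (θ : Vec d) : ∫ x, shiftDensity θ x ∂(gauss d) = 1 := by
  unfold shiftDensity
  simp_rw [Real.exp_sub]
  rw [integral_div, integral_exp_inner, div_self (Real.exp_pos _).ne']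

lemma isProbabilityMeasure_withDensity_shiftDensity (θ : Vec d) : IsProbabilityMeasure
    ((gauss d).withDensity fun x => ENNReal.ofReal (shiftDensity θ x)) := by
  constructor
  rw [withDensity_apply _ MeasurableSet.univ, Measure.restrict_univ,
    ← ofReal_integral_eq_lintegral_ofReal (integrable_shiftDensity θ)
      (ae_of_all _ fun x => (shiftDensity_pos θ x).le), integral_shiftDensity, ENNReal.ofReal_one]

lemma integral_withDensity_shiftDensity {F : Type*} [NormedAddCommGroup F] [NormedSpace ℝ F]
    (θ : Vec d) (f : Vec d → F) :
    ∫ x, f x ∂((gauss d).withDensity fun x => ENNReal.ofReal (shiftDensity θ x))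
      = ∫ x, shiftDensity θ x • f x ∂(gauss d) := by
  rw [integral_withDensity_eq_integral_toReal_smul
    (measurable_shiftDensity θ).ennreal_ofReal (ae_of_all _ fun x => ENNReal.ofReal_lt_top)]
  simp_rw [ENNReal.toReal_ofReal (shiftDensity_pos θ _).le]

lemma integrable_withDensity_shiftDensity_iff {F : Type*} [NormedAddCommGroup F] [NormedSpace ℝ F]
    (θ : Vec d) (f : Vec d → F) :
    Integrable f ((gauss d).withDensity fun x => ENNReal.ofReal (shiftDensity θ x))
      ↔ Integrable (fun x => shiftDensity θ x • f x) (gauss d) := by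
  rw [integrable_withDensity_iff_integrable_smul'
    (measurable_shiftDensity θ).ennreal_ofReal (ae_of_all _ fun x => ENNReal.ofReal_lt_top)]
  simp_rw [ENNReal.toReal_ofReal (shiftDensity_pos θ _).le]

/-- The **Cameron-Martin formula** in finite dimension. -/
theorem gauss_map_add_const (θ : Vec d) : (gauss d).map (· + θ)
    = (gauss d).withDensity fun x => ENNReal.ofReal (shiftDensity θ x) := by
  have := isProbabilityMeasure_withDensity_shiftDensity θ
  have : IsProbabilityMeasure ((gauss d).map (· + θ)) :=
    Measure.isProbabilityMeasure_map (by fun_prop)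
  refine Measure.ext_of_charFun (funext fun t => ?_)
  -- Real exponential moments are explicit on both sides. Being finite everywhere, they determine
  -- the complex moment generating function on the whole plane by analytic continuation; its value
  -- at `I` is the characteristic function.
  have hm : mgf (fun x => ⟪t, x⟫) ((gauss d).map (· + θ)) = mgf (fun x => ⟪t, x⟫)
      ((gauss d).withDensity fun x => ENNReal.ofReal (shiftDensity θ x)) := by
    ext s
    unfold mgf
    rw [integral_withDensity_shiftDensity, integral_map (by fun_prop) (by fun_prop)]
    have h1 (x : Vec d) : Real.exp (s * ⟪t, x + θ⟫)
        = Real.exp ⟪s • t, x⟫ * Real.exp (s * ⟪t, θ⟫) := by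
      rw [← Real.exp_add, inner_add_right, real_inner_smul_left]; ring_nf
    have h2 (x : Vec d) : shiftDensity θ x • Real.exp (s * ⟪t, x⟫)
        = Real.exp ⟪θ + s • t, x⟫ * Real.exp (- ‖θ‖ ^ 2 / 2) := by
      rw [shiftDensity, smul_eq_mul, ← Real.exp_add, ← Real.exp_add, inner_add_left,
        real_inner_smul_left]; ring_nf
    simp_rw [h1, h2]
    rw [integral_mul_const, integral_mul_const, integral_exp_inner, integral_exp_inner,
      ← Real.exp_add, ← Real.exp_add, norm_add_sq_real, real_inner_smul_right, real_inner_comm]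
    ring_nf
  have hset : integrableExpSet (fun x => ⟪t, x⟫) ((gauss d).map (· + θ)) = Set.univ := by
    refine Set.eq_univ_of_forall fun s => ?_
    rw [integrableExpSet, Set.mem_ofPred_eq, integrable_map_measure (by fun_prop) (by fun_prop)]
    refine ((integrable_exp_inner (s • t)).mul_const (Real.exp (s * ⟪t, θ⟫))).congr
      (ae_of_all _ fun x => ?_)
    simp only [Function.comp_def]
    rw [← Real.exp_add, inner_add_right, real_inner_smul_left]; ring_nf
  have h := eqOn_complexMGF_of_mgf hm (x := Complex.I) (by simp [hset])
  simpa [charFun_apply, complexMGF, mul_comm Complex.I, real_inner_comm] using h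

/-- The change of measure attached to the translation by `θ`. -/
lemma integral_comp_add_gauss {F : Type*} [NormedAddCommGroup F] [NormedSpace ℝ F]
    (θ : Vec d) (f : Vec d → F) :
    ∫ x, f (x + θ) ∂(gauss d) = ∫ x, shiftDensity θ x • f x ∂(gauss d) := by
  rw [← integral_withDensity_shiftDensity, ← gauss_map_add_const]
  exact ((MeasurableEquiv.addRight θ).measurableEmbedding.integral_map f).symm

lemma integrable_comp_add_gauss_iff {F : Type*} [NormedAddCommGroup F] [NormedSpace ℝ F]
    (θ : Vec d) (f : Vec d → F) :
    Integrable (fun x => f (x + θ)) (gauss d)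
      ↔ Integrable (fun x => shiftDensity θ x • f x) (gauss d) := by
  rw [← integrable_withDensity_shiftDensity_iff, ← gauss_map_add_const]
  exact ((MeasurableEquiv.addRight θ).measurableEmbedding.integrable_map_iff).symm

end Gaussian

/-! ### Undoing the shift: weights, moments and envelopes. -/

section Weights

variable {d : ℕ} {φ : Vec d → ℝ}

/-- The unshifted form `x ↦ φ(x) exp(-θ·x + |θ|²/2)` of the integrand `shifted φ θ`. -/
noncomputable def weighted (φ : Vec d → ℝ) (θ x : Vec d) : ℝ :=
  φ x * Real.exp (-⟪θ, x⟫ + ‖θ‖ ^ 2 / 2)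

lemma shifted_eq_weighted (φ : Vec d → ℝ) (θ x : Vec d) :
    shifted φ θ x = weighted φ θ (x + θ) := by
  rw [shifted, weighted, inner_add_right, real_inner_self_eq_norm_sq]
  ring_nf

/-- The two exponents are opposite. This cancellation makes both the mean and the `L¹` norm of
`shifted φ θ` independent of `θ`; for the square, one inverse density survives and produces
`criterion`. -/
lemma shiftDensity_mul_weighted (φ : Vec d → ℝ) (θ x : Vec d) :
    shiftDensity θ x * weighted φ θ x = φ x := by
  rw [shiftDensity, weighted, mul_left_comm, ← Real.exp_add]
  simp

lemma shiftDensity_mul_weighted_sq (φ : Vec d → ℝ) (θ x : Vec d) :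
    shiftDensity θ x * weighted φ θ x ^ 2 = criterion φ θ x := by
  rw [sq, ← mul_assoc, shiftDensity_mul_weighted, weighted, criterion]
  ring

lemma integral_comp_shifted {F : Type*} [NormedAddCommGroup F] [NormedSpace ℝ F]
    (θ : Vec d) (f : ℝ → F) :
    ∫ x, f (shifted φ θ x) ∂(gauss d) = ∫ x, shiftDensity θ x • f (weighted φ θ x) ∂(gauss d) := by
  simp_rw [shifted_eq_weighted]
  exact integral_comp_add_gauss θ fun x => f (weighted φ θ x)

lemma integrable_comp_shifted_iff {F : Type*} [NormedAddCommGroup F] [NormedSpace ℝ F]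
    (θ : Vec d) (f : ℝ → F) :
    Integrable (fun x => f (shifted φ θ x)) (gauss d)
      ↔ Integrable (fun x => shiftDensity θ x • f (weighted φ θ x)) (gauss d) := by
  simp_rw [shifted_eq_weighted]
  exact integrable_comp_add_gauss_iff θ fun x => f (weighted φ θ x)

lemma measurable_shifted_uncurry (hφ : Measurable φ) :
    Measurable fun p : Vec d × Vec d => shifted φ p.1 p.2 := by
  unfold shifted; fun_prop

lemma measurable_shifted (hφ : Measurable φ) (θ : Vec d) : Measurable (shifted φ θ) := by
  unfold shifted; fun_prop

lemma measurable_weighted (hφ : Measurable φ) (θ : Vec d) : Measurable (weighted φ θ) := by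
  unfold weighted; fun_prop

lemma measurable_criterion (hφ : Measurable φ) (θ : Vec d) : Measurable (criterion φ θ) := by
  unfold criterion; fun_prop

/-- The Euclidean norm is at most the `ℓ¹` norm, which is a linear form for the sign vector of `x`.
Finitely many linear tilts therefore control the exponential of the norm, which supplies dominating
functions uniform over bounded sets of parameters. -/
lemma exp_mul_norm_le_sum {K : ℝ} (hK : 0 ≤ K) (x : Vec d) : Real.exp (K * ‖x‖)
    ≤ ∑ s : Fin d → SignType, Real.exp (-⟪WithLp.toLp 2 fun i => K * (s i : ℝ), x⟫) := by
  have h1 : ‖x‖ ≤ ∑ i, |x i| := by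
    rw [EuclideanSpace.norm_eq]
    refine Real.sqrt_le_iff.2 ⟨Finset.sum_nonneg fun i _ => abs_nonneg _, ?_⟩
    simp_rw [Real.norm_eq_abs]
    exact Finset.sum_sq_le_sq_sum_of_nonneg fun i _ => abs_nonneg _
  refine le_trans ?_ (Finset.single_le_sum (f := fun s : Fin d → SignType =>
    Real.exp (-⟪WithLp.toLp 2 fun i => K * (s i : ℝ), x⟫)) (fun s _ => (Real.exp_pos _).le)
    (Finset.mem_univ fun i => - SignType.sign (x i)))
  refine Real.exp_le_exp.2 ((mul_le_mul_of_nonneg_left h1 hK).trans (le_of_eq ?_))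
  rw [PiLp.inner_apply, Finset.mul_sum, ← Finset.sum_neg_distrib]
  refine Finset.sum_congr rfl fun i _ => ?_
  simp [← sign_mul_self]
  ring

/-- The square integrability of `φ` against all exponential tilts of the Gaussian law. -/
def TiltIntegrable (φ : Vec d → ℝ) : Prop :=
  ∀ θ : Vec d, Integrable (fun x => φ x ^ 2 * Real.exp (-⟪θ, x⟫)) (gauss d)

lemma TiltIntegrable.exp_norm (h : TiltIntegrable φ) (hφ : Measurable φ) (K : ℝ) :
    Integrable (fun x => φ x ^ 2 * Real.exp (K * ‖x‖)) (gauss d) := by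
  refine (integrable_finsetSum Finset.univ fun (s : Fin d → SignType) _ =>
    h (WithLp.toLp 2 fun i => |K| * (s i : ℝ))).mono' (by fun_prop) (ae_of_all _ fun x => ?_)
  rw [Real.norm_eq_abs, abs_mul, abs_of_nonneg (sq_nonneg _), Real.abs_exp, ← Finset.mul_sum]
  refine mul_le_mul_of_nonneg_left (le_trans ?_ (exp_mul_norm_le_sum (abs_nonneg K) x))
    (sq_nonneg _)
  exact Real.exp_le_exp.2 (mul_le_mul_of_nonneg_right (le_abs_self K) (norm_nonneg x))

lemma integrable_exp_norm (K : ℝ) : Integrable (fun x => Real.exp (K * ‖x‖)) (gauss d) := by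
  have : TiltIntegrable fun _ : Vec d => (1 : ℝ) := fun θ => by
    simpa using integrable_exp_inner (-θ)
  simpa using this.exp_norm measurable_const K

lemma TiltIntegrable.memLp (h : TiltIntegrable φ) (hφ : Measurable φ) : MemLp φ 2 (gauss d) :=
  (memLp_two_iff_integrable_sq hφ.aestronglyMeasurable).2 (by simpa using h 0)

lemma TiltIntegrable.integrable (h : TiltIntegrable φ) (hφ : Measurable φ) :
    Integrable φ (gauss d) := (h.memLp hφ).integrable (by norm_num)

lemma TiltIntegrable.criterion (h : TiltIntegrable φ) (θ : Vec d) :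
    Integrable (criterion φ θ) (gauss d) := by
  refine ((h θ).mul_const (Real.exp (‖θ‖ ^ 2 / 2))).congr (ae_of_all _ fun x => ?_)
  simp only [AdaptiveIS.criterion, Real.exp_add, mul_assoc]

lemma TiltIntegrable.memLp_shifted (h : TiltIntegrable φ) (hφ : Measurable φ) (θ : Vec d) :
    MemLp (shifted φ θ) 2 (gauss d) := by
  rw [memLp_two_iff_integrable_sq (measurable_shifted hφ θ).aestronglyMeasurable,
    integrable_comp_shifted_iff θ fun y : ℝ => y ^ 2]
  simpa only [smul_eq_mul, shiftDensity_mul_weighted_sq] using h.criterion θ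

lemma TiltIntegrable.integrable_shifted (h : TiltIntegrable φ) (hφ : Measurable φ) (θ : Vec d) :
    Integrable (shifted φ θ) (gauss d) := (h.memLp_shifted hφ θ).integrable (by norm_num)

lemma integral_shifted (φ : Vec d → ℝ) (θ : Vec d) :
    ∫ x, shifted φ θ x ∂(gauss d) = ∫ x, φ x ∂(gauss d) := by
  simpa only [smul_eq_mul, shiftDensity_mul_weighted] using
    integral_comp_shifted (φ := φ) θ fun y => y

lemma integral_abs_shifted (φ : Vec d → ℝ) (θ : Vec d) :
    ∫ x, |shifted φ θ x| ∂(gauss d) = ∫ x, |φ x| ∂(gauss d) := by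
  rw [integral_comp_shifted θ fun y : ℝ => |y|]
  refine integral_congr_ae (ae_of_all _ fun x => ?_)
  simp only [smul_eq_mul]
  rw [← abs_of_pos (shiftDensity_pos θ x), ← abs_mul, shiftDensity_mul_weighted]

lemma integral_shifted_sq (φ : Vec d → ℝ) (θ : Vec d) :
    ∫ x, shifted φ θ x ^ 2 ∂(gauss d) = v φ θ := by
  rw [integral_comp_shifted θ fun y : ℝ => y ^ 2]
  simp only [smul_eq_mul, shiftDensity_mul_weighted_sq, v]

lemma TiltIntegrable.variance_shifted (h : TiltIntegrable φ) (hφ : Measurable φ) (θ : Vec d) :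
    Var[shifted φ θ; gauss d] = v φ θ - (∫ x, φ x ∂(gauss d)) ^ 2 := by
  rw [variance_eq_sub (h.memLp_shifted hφ θ), integral_shifted]
  simp only [Pi.pow_apply, integral_shifted_sq]

lemma shiftDensity_le {M : ℝ} {θ : Vec d} (hθ : ‖θ‖ ≤ M) (x : Vec d) :
    shiftDensity θ x ≤ Real.exp (M * ‖x‖) := by
  refine Real.exp_le_exp.2 ?_
  have h1 := real_inner_le_norm θ x
  have h2 := mul_le_mul_of_nonneg_right hθ (norm_nonneg x)
  nlinarith [sq_nonneg ‖θ‖]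

/-- A common bound for the functions `weighted φ θ` with `‖θ‖ ≤ M`. -/
noncomputable def envelope (φ : Vec d → ℝ) (M : ℝ) (x : Vec d) : ℝ :=
  |φ x| * Real.exp (M * ‖x‖ + M ^ 2 / 2)

lemma envelope_nonneg (φ : Vec d → ℝ) (M : ℝ) (x : Vec d) : 0 ≤ envelope φ M x :=
  mul_nonneg (abs_nonneg _) (Real.exp_pos _).le

lemma exp_neg_inner_add_le {M : ℝ} {θ : Vec d} (hθ : ‖θ‖ ≤ M) (x : Vec d) :
    Real.exp (-⟪θ, x⟫ + ‖θ‖ ^ 2 / 2) ≤ Real.exp (M * ‖x‖ + M ^ 2 / 2) := by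
  refine Real.exp_le_exp.2 ?_
  have h1 := neg_le_of_abs_le (abs_real_inner_le_norm θ x)
  have h2 := mul_le_mul_of_nonneg_right hθ (norm_nonneg x)
  nlinarith [norm_nonneg θ]

lemma abs_weighted_le {M : ℝ} {θ : Vec d} (hθ : ‖θ‖ ≤ M) (x : Vec d) :
    |weighted φ θ x| ≤ envelope φ M x := by
  rw [weighted, abs_mul, Real.abs_exp]
  exact mul_le_mul_of_nonneg_left (exp_neg_inner_add_le hθ x) (abs_nonneg _)

lemma TiltIntegrable.envelope_sq (h : TiltIntegrable φ) (hφ : Measurable φ) (M : ℝ) :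
    Integrable (fun x => Real.exp (M * ‖x‖) * envelope φ M x ^ 2) (gauss d) := by
  -- One factor `exp (M * ‖x‖)` bounds the density and two come from the squared envelope, hence `3
  -- * M`.
  refine ((h.exp_norm hφ (3 * M)).mul_const (Real.exp (M ^ 2))).congr (ae_of_all _ fun x => ?_)
  simp only [envelope, mul_pow, sq_abs, ← Real.exp_nat_mul]
  rw [mul_left_comm, ← Real.exp_add, mul_assoc, ← Real.exp_add]
  push_cast
  ring_nf

end Weights

/-! ### Convexity of the criterion and consistency of its empirical minimizers. -/

section Optimization

variable {d : ℕ} {φ : Vec d → ℝ}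

lemma criterion_nonneg (φ : Vec d → ℝ) (θ x : Vec d) : 0 ≤ criterion φ θ x :=
  mul_nonneg (sq_nonneg _) (Real.exp_pos _).le

/-- The gradient of `criterion φ · x` at `θ`. -/
noncomputable def score (φ : Vec d → ℝ) (θ x : Vec d) : Vec d := criterion φ θ x • (θ - x)

lemma measurable_score (hφ : Measurable φ) (θ : Vec d) : Measurable (score φ θ) := by
  have := measurable_criterion hφ θ
  unfold score; fun_prop

/-- Expanding the exponent around `s` produces an exact linear term and the square `‖t - s‖ ^ 2 /
2`; then `1 + u ≤ exp u` applies. The bound is linear in `criterion φ s x` and `score φ s x`, so it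
passes to integrals and to empirical means. -/
lemma criterion_lower_bound (φ : Vec d → ℝ) (s t x : Vec d) :
    criterion φ s x * (1 + ‖t - s‖ ^ 2 / 2) + ⟪score φ s x, t - s⟫ ≤ criterion φ t x := by
  have h1 : -⟪t, x⟫ + ‖t‖ ^ 2 / 2
      = (-⟪s, x⟫ + ‖s‖ ^ 2 / 2) + (⟪s - x, t - s⟫ + ‖t - s‖ ^ 2 / 2) := by
    rw [norm_sub_sq_real, inner_sub_left, inner_sub_right, inner_sub_right,
      real_inner_self_eq_norm_sq, real_inner_comm x t, real_inner_comm x s, real_inner_comm s t]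
    ring
  have h2 := Real.add_one_le_exp (⟪s - x, t - s⟫ + ‖t - s‖ ^ 2 / 2)
  rw [score, real_inner_smul_left, ← mul_add]
  nth_rw 2 [criterion]
  rw [h1, Real.exp_add, ← mul_assoc]
  exact mul_le_mul_of_nonneg_left (by linarith) (criterion_nonneg φ s x)

lemma criterion_le {M : ℝ} {θ : Vec d} (hθ : ‖θ‖ ≤ M) (x : Vec d) :
    criterion φ θ x ≤ Real.exp (M ^ 2 / 2) * (φ x ^ 2 * Real.exp (M * ‖x‖)) := by
  rw [mul_left_comm, ← Real.exp_add, add_comm (M ^ 2 / 2)]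
  exact mul_le_mul_of_nonneg_left (exp_neg_inner_add_le hθ x) (sq_nonneg _)

/-- The linear factor `‖θ - x‖` is absorbed by raising the exponential rate from `M` to `M + 1`. -/
lemma norm_score_le {M : ℝ} {θ : Vec d} (hθ : ‖θ‖ ≤ M) (x : Vec d) : ‖score φ θ x‖
    ≤ Real.exp (M ^ 2 / 2) * Real.exp M * (φ x ^ 2 * Real.exp ((M + 1) * ‖x‖)) := by
  rw [score, norm_smul, Real.norm_of_nonneg (criterion_nonneg φ θ x)]
  have h1 : ‖θ - x‖ ≤ Real.exp (M + ‖x‖) := by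
    have := norm_sub_le θ x
    linarith [Real.add_one_le_exp (M + ‖x‖)]
  refine (mul_le_mul (criterion_le hθ x) h1 (norm_nonneg _) (by positivity)).trans (le_of_eq ?_)
  rw [add_mul, one_mul, Real.exp_add, Real.exp_add]
  ring

lemma TiltIntegrable.score (h : TiltIntegrable φ) (hφ : Measurable φ) (θ : Vec d) :
    Integrable (score φ θ) (gauss d) :=
  ((h.exp_norm hφ (‖θ‖ + 1)).const_mul _).mono' (measurable_score hφ θ).aestronglyMeasurable
    (ae_of_all _ fun x => norm_score_le le_rfl x)

lemma eventually_norm_le (θ : Vec d) : ∀ᶠ t in 𝓝 θ, ‖t‖ ≤ ‖θ‖ + 1 := by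
  filter_upwards [(continuous_norm.tendsto θ).eventually (gt_mem_nhds (lt_add_one ‖θ‖))] with t ht
  exact ht.le

lemma continuous_criterion (φ : Vec d → ℝ) (x : Vec d) : Continuous fun θ => criterion φ θ x := by
  unfold criterion; fun_prop

lemma TiltIntegrable.continuous_v (h : TiltIntegrable φ) (hφ : Measurable φ) :
    Continuous (v φ) := by
  refine continuous_iff_continuousAt.2 fun θ => ?_
  refine continuousAt_of_dominated
    (Eventually.of_forall fun t => (measurable_criterion hφ t).aestronglyMeasurable) ?_
    ((h.exp_norm hφ (‖θ‖ + 1)).const_mul (Real.exp ((‖θ‖ + 1) ^ 2 / 2)))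
    (ae_of_all _ fun x => (continuous_criterion φ x).continuousAt)
  filter_upwards [eventually_norm_le θ] with t ht
  refine ae_of_all _ fun x => ?_
  rw [Real.norm_of_nonneg (criterion_nonneg φ t x)]
  exact criterion_le ht x

lemma TiltIntegrable.continuous_integral_score (h : TiltIntegrable φ) (hφ : Measurable φ) :
    Continuous fun θ => ∫ x, AdaptiveIS.score φ θ x ∂(gauss d) := by
  refine continuous_iff_continuousAt.2 fun θ => ?_
  refine continuousAt_of_dominated
    (Eventually.of_forall fun t => (measurable_score hφ t).aestronglyMeasurable) ?_
    ((h.exp_norm hφ (‖θ‖ + 1 + 1)).const_mul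
      (Real.exp ((‖θ‖ + 1) ^ 2 / 2) * Real.exp (‖θ‖ + 1)))
    (ae_of_all _ fun x => Continuous.continuousAt ?_)
  · filter_upwards [eventually_norm_le θ] with t ht
    exact ae_of_all _ fun x => norm_score_le ht x
  · have := continuous_criterion φ x
    unfold AdaptiveIS.score; fun_prop

lemma TiltIntegrable.v_lower_bound (h : TiltIntegrable φ) (hφ : Measurable φ) (s t : Vec d) :
    v φ s * (1 + ‖t - s‖ ^ 2 / 2) + ⟪∫ x, AdaptiveIS.score φ s x ∂(gauss d), t - s⟫ ≤ v φ t := by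
  have h1 : ⟪∫ x, AdaptiveIS.score φ s x ∂(gauss d), t - s⟫
      = ∫ x, ⟪AdaptiveIS.score φ s x, t - s⟫ ∂(gauss d) := by
    simp_rw [real_inner_comm (t - s)]
    exact (integral_inner (h.score hφ s) (t - s)).symm
  rw [h1, v, v, ← integral_mul_const, ← integral_add ((h.criterion s).mul_const _)
    ((h.score hφ s).inner_const _)]
  exact integral_mono (((h.criterion s).mul_const _).add ((h.score hφ s).inner_const _))
    (h.criterion t) fun x => criterion_lower_bound φ s t x

lemma TiltIntegrable.v_pos (h : TiltIntegrable φ) (hpos : 0 < gauss d {x | φ x ≠ 0})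
    (θ : Vec d) : 0 < v φ θ := by
  rw [v, integral_pos_iff_support_of_nonneg (criterion_nonneg φ θ) (h.criterion θ)]
  convert hpos using 2
  ext x
  simp [AdaptiveIS.criterion]

/-- The second moment `v φ` attains its minimum at a point where the mean score vanishes. -/
lemma TiltIntegrable.exists_integral_score_eq_zero (h : TiltIntegrable φ) (hφ : Measurable φ)
    (hpos : 0 < gauss d {x | φ x ≠ 0}) :
    ∃ θ : Vec d, ∫ x, AdaptiveIS.score φ θ x ∂(gauss d) = 0 := by
  set G : Vec d → Vec d := fun θ => ∫ x, AdaptiveIS.score φ θ x ∂(gauss d) with hG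
  -- The lower bound at `s = 0` grows quadratically, because `v φ 0 > 0`.
  have hlim : Tendsto (v φ) (cocompact (Vec d)) atTop := by
    refine tendsto_atTop_mono (f := fun t => ‖t‖ * (v φ 0 / 2 * ‖t‖ - ‖G 0‖)) (fun t => ?_) ?_
    · have h1 := h.v_lower_bound hφ 0 t
      have h2 := neg_le_of_abs_le (abs_real_inner_le_norm (G 0) (t - 0))
      have h3 := h.v_pos hpos 0
      rw [sub_zero] at h1 h2
      nlinarith
    · refine Tendsto.comp (g := fun r : ℝ => r * (v φ 0 / 2 * r - ‖G 0‖)) ?_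
        (tendsto_norm_cocompact_atTop (E := Vec d))
      exact tendsto_id.atTop_mul_atTop₀ (tendsto_atTop_add_const_right _ _
        (tendsto_id.const_mul_atTop (half_pos (h.v_pos hpos 0))))
  obtain ⟨θ, hθ⟩ := (h.continuous_v hφ).exists_forall_le hlim
  refine ⟨θ, ?_⟩
  -- No differentiation under the integral is needed: the lower bound based at `θ + r • e` and
  -- evaluated at the minimizer `θ` gives `0 ≤ ⟪G (θ + r • e), e⟫`, and `r` decreases to `0`. The
  -- choice `e = -G θ` then forces `G θ = 0`.
  have hdir (e : Vec d) : 0 ≤ ⟪G θ, e⟫ := by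
    have hc : Tendsto (fun r : ℝ => ⟪G (θ + r • e), e⟫) (𝓝[>] 0) (𝓝 ⟪G θ, e⟫) := by
      have : Continuous fun r : ℝ => ⟪G (θ + r • e), e⟫ :=
        ((h.continuous_integral_score hφ).comp (by fun_prop : Continuous fun r : ℝ => θ + r • e)).inner
          continuous_const
      simpa using (this.tendsto 0).mono_left nhdsWithin_le_nhds
    refine ge_of_tendsto hc ?_
    filter_upwards [self_mem_nhdsWithin] with r hr
    have hr : (0 : ℝ) < r := hr
    have h1 := h.v_lower_bound hφ (θ + r • e) θ
    have h2 : θ - (θ + r • e) = -(r • e) := by abel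
    rw [h2, inner_neg_right, real_inner_smul_right] at h1
    have h3 := hθ (θ + r • e)
    have h4 := mul_nonneg (h.v_pos hpos (θ + r • e)).le (sq_nonneg ‖-(r • e)‖)
    exact nonneg_of_mul_nonneg_right (by linarith) hr
  have := hdir (- G θ)
  rw [inner_neg_right, real_inner_self_eq_norm_sq] at this
  exact norm_eq_zero.1 (by nlinarith [norm_nonneg (G θ)])

lemma TiltIntegrable.v_lt (h : TiltIntegrable φ) (hφ : Measurable φ)
    (hpos : 0 < gauss d {x | φ x ≠ 0}) {θ t : Vec d}
    (hθ : ∫ x, AdaptiveIS.score φ θ x ∂(gauss d) = 0) (ht : t ≠ θ) : v φ θ < v φ t := by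
  have h1 := h.v_lower_bound hφ θ t
  rw [hθ, inner_zero_left] at h1
  nlinarith [mul_pos (h.v_pos hpos θ) (pow_pos (norm_pos_iff.2 (sub_ne_zero.2 ht)) 2)]

lemma vEmp_lower_bound (φ : Vec d → ℝ) (x : ℕ → Vec d) (n : ℕ) (s t : Vec d) :
    vEmp φ x n s * (1 + ‖t - s‖ ^ 2 / 2)
      + ⟪(n : ℝ)⁻¹ • ∑ i ∈ Finset.range n, score φ s (x i), t - s⟫ ≤ vEmp φ x n t := by
  rw [vEmp, vEmp, one_div, real_inner_smul_left, mul_assoc, ← mul_add, sum_inner, Finset.sum_mul,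
    ← Finset.sum_add_distrib]
  exact mul_le_mul_of_nonneg_left
    (Finset.sum_le_sum fun i _ => criterion_lower_bound φ s t (x i)) (by positivity)

/-- A minimizer of the empirical criterion is close to `s` if the empirical score at `s` is
small. -/
lemma norm_sub_le_of_isMin {x : ℕ → Vec d} {n : ℕ} {s t : Vec d}
    (hv : 0 < vEmp φ x n s) (ht : vEmp φ x n t ≤ vEmp φ x n s) :
    ‖t - s‖ ≤ 2 * ‖(n : ℝ)⁻¹ • ∑ i ∈ Finset.range n, score φ s (x i)‖ / vEmp φ x n s := by
  have h1 := vEmp_lower_bound φ x n s t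
  have h2 := neg_le_of_abs_le (abs_real_inner_le_norm
    ((n : ℝ)⁻¹ • ∑ i ∈ Finset.range n, score φ s (x i)) (t - s))
  rw [le_div_iff₀ hv]
  -- Minimality leaves a quadratic term in `‖t - s‖` bounded by a linear one; one factor is
  -- cancelled when it is nonzero.
  rcases (norm_nonneg (t - s)).eq_or_lt with h0 | h0
  · rw [← h0, zero_mul]; positivity
  · refine le_of_mul_le_mul_right ?_ h0
    nlinarith

/-- Strong consistency of the minimizers of the empirical criterion. -/
theorem TiltIntegrable.tendsto_argmin (h : TiltIntegrable φ) (hφ : Measurable φ)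
    (hpos : 0 < gauss d {x | φ x ≠ 0}) {θs : Vec d}
    (hθs : ∫ x, AdaptiveIS.score φ θs x ∂(gauss d) = 0)
    {Ω : Type*} [MeasurableSpace Ω] {P : Measure Ω} {X : ℕ → Ω → Vec d}
    (hXm : ∀ i, Measurable (X i)) (hXlaw : ∀ i, P.map (X i) = gauss d) (hX : iIndepFun X P)
    {θ : ℕ → Ω → Vec d}
    (hθ : ∀ n, ∀ᵐ ω ∂P, ∀ t, vEmp φ (fun i => X i ω) n (θ n ω) ≤ vEmp φ (fun i => X i ω) n t) :
    ∀ᵐ ω ∂P, Tendsto (fun n => θ n ω) atTop (𝓝 θs) := by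
  have hid (i : ℕ) : IdentDistrib (X i) (X 0) P P :=
    ⟨(hXm i).aemeasurable, (hXm 0).aemeasurable, by rw [hXlaw, hXlaw]⟩
  have hslln {F : Type} [NormedAddCommGroup F] [NormedSpace ℝ F] [CompleteSpace F]
      [MeasurableSpace F] [BorelSpace F] [SecondCountableTopology F] {f : Vec d → F}
      (hf : Measurable f) (hfi : Integrable f (gauss d)) :
      ∀ᵐ ω ∂P, Tendsto (fun n : ℕ => (n : ℝ)⁻¹ • ∑ i ∈ Finset.range n, f (X i ω)) atTop
        (𝓝 (∫ x, f x ∂(gauss d))) := by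
    have h0 := hfi
    rw [← hXlaw 0, integrable_map_measure hf.aestronglyMeasurable (hXm 0).aemeasurable] at h0
    have := strong_law_ae (fun i ω => f (X i ω)) h0
      (fun i j hij => (hX.indepFun hij).comp hf hf) fun i => (hid i).comp hf
    rwa [← hXlaw 0, integral_map (hXm 0).aemeasurable hf.aestronglyMeasurable]
  filter_upwards [hslln (measurable_criterion hφ θs) (h.criterion θs),
    hslln (measurable_score hφ θs) (h.score hφ θs), ae_all_iff.2 hθ] with ω h1 h2 h3
  have h1' : Tendsto (fun n => vEmp φ (fun i => X i ω) n θs) atTop (𝓝 (v φ θs)) := by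
    simpa only [vEmp, one_div, smul_eq_mul, v] using h1
  rw [hθs] at h2
  rw [tendsto_iff_norm_sub_tendsto_zero]
  -- The distance bound tends to `0` because the empirical score at `θs` vanishes in the limit while
  -- the empirical criterion there tends to `v φ θs > 0`.
  have hlim := (h2.norm.const_mul 2).div h1' (h.v_pos hpos θs).ne'
  rw [norm_zero, mul_zero, zero_div] at hlim
  refine squeeze_zero' (Eventually.of_forall fun n => norm_nonneg _) ?_ hlim
  filter_upwards [h1'.eventually (lt_mem_nhds (h.v_pos hpos θs))] with n hn
  exact norm_sub_le_of_isMin hn (h3 n θs)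

end Optimization

/-! ### A strong law for triangular arrays by truncation and fourth moments. -/

section CompleteConvergence

/-- The sum of the series has finite integral, hence is almost surely finite, so its terms tend to
`0`. -/
lemma ae_tendsto_zero_of_summable_integral {Ω : Type*} [MeasurableSpace Ω] {P : Measure Ω}
    {f : ℕ → Ω → ℝ} (hf : ∀ m, Integrable (f m) P) (hf0 : ∀ m ω, 0 ≤ f m ω)
    (hs : Summable fun m => ∫ ω, f m ω ∂P) : ∀ᵐ ω ∂P, Tendsto (fun m => f m ω) atTop (𝓝 0) := by
  have h1 : ∫⁻ ω, ∑' m, ENNReal.ofReal (f m ω) ∂P ≠ ⊤ := by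
    rw [lintegral_tsum fun m => (hf m).aemeasurable.ennreal_ofReal]
    simp_rw [← ofReal_integral_eq_lintegral_ofReal (hf _) (ae_of_all _ (hf0 _))]
    exact hs.tsum_ofReal_ne_top
  filter_upwards [ae_lt_top' (AEMeasurable.tsum fun m =>
    (hf m).aemeasurable.ennreal_ofReal) h1] with ω hω
  have h2 := ENNReal.tendsto_atTop_zero_of_tsum_ne_top hω.ne
  have h3 := (ENNReal.tendsto_toReal ENNReal.zero_ne_top).comp h2
  simpa [Function.comp_def, ENNReal.toReal_ofReal (hf0 _ _)] using h3

/-- Moment bounds of orders two and four for a sum of bounded centred independent variables. -/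
lemma integral_sum_pow_le {Ω : Type*} [MeasurableSpace Ω] {P : Measure Ω} [IsProbabilityMeasure P]
    {Z : ℕ → Ω → ℝ} (hZm : ∀ i, Measurable (Z i)) (hZ : iIndepFun Z P) {B s κ : ℝ}
    (hB : ∀ i ω, |Z i ω| ≤ B) (h1 : ∀ i, ∫ ω, Z i ω ∂P = 0) (h2 : ∀ i, ∫ ω, Z i ω ^ 2 ∂P ≤ s)
    (h4 : ∀ i, ∫ ω, Z i ω ^ 4 ∂P ≤ κ) (k : ℕ) :
    ∫ ω, (∑ i ∈ Finset.range k, Z i ω) ^ 2 ∂P ≤ k * s ∧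
      ∫ ω, (∑ i ∈ Finset.range k, Z i ω) ^ 4 ∂P ≤ k * κ + 3 * k ^ 2 * s ^ 2 := by
  induction k with
  | zero => simp
  | succ k ih =>
    set S : Ω → ℝ := fun ω => ∑ i ∈ Finset.range k, Z i ω with hS
    have hSm : Measurable S := Finset.measurable_fun_sum _ fun i _ => hZm i
    have hSb (ω : Ω) : |S ω| ≤ k * B := by
      refine (Finset.abs_sum_le_sum_abs _ _).trans ?_
      refine (Finset.sum_le_sum fun i _ => hB i ω).trans (by simp)
    have hind : IndepFun S (Z k) P := by
      have := hZ.indepFun_finsetSum_of_notMem hZm (s := Finset.range k) (i := k) (by simp)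
      rwa [show (∑ j ∈ Finset.range k, Z j) = S from by ext ω; simp [hS]] at this
    have hint (a b : ℕ) : Integrable (fun ω => S ω ^ a * Z k ω ^ b) P := by
      refine Integrable.of_bound (by fun_prop (disch := exact hZm k)) ((k * B) ^ a * B ^ b)
        (ae_of_all _ fun ω => ?_)
      rw [norm_mul, norm_pow, norm_pow]
      exact mul_le_mul (pow_le_pow_left₀ (norm_nonneg _) (hSb ω) a)
        (pow_le_pow_left₀ (norm_nonneg _) (hB k ω) b) (by positivity)
        (pow_nonneg ((abs_nonneg _).trans (hSb ω)) a)
    have hmul (a b : ℕ) : ∫ ω, S ω ^ a * Z k ω ^ b ∂P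
        = (∫ ω, S ω ^ a ∂P) * ∫ ω, Z k ω ^ b ∂P :=
      (hind.comp (measurable_id.pow_const a) (measurable_id.pow_const b)).integral_fun_mul_eq_mul_integral
        (hSm.pow_const a).aestronglyMeasurable ((hZm k).pow_const b).aestronglyMeasurable
    have hS1 : ∫ ω, S ω ∂P = 0 := by
      rw [integral_finsetSum _ fun i _ => Integrable.of_bound (hZm i).aestronglyMeasurable B
        (ae_of_all _ (hB i))]
      simp [h1]
    have hs0 : 0 ≤ s := (integral_nonneg fun ω => sq_nonneg _).trans (h2 k)
    have hS20 : 0 ≤ ∫ ω, S ω ^ 2 ∂P := integral_nonneg fun ω => sq_nonneg _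
    have hZ20 : 0 ≤ ∫ ω, Z k ω ^ 2 ∂P := integral_nonneg fun ω => sq_nonneg _
    -- Zero exponents are kept so that every monomial has the shape handled by `hint` and `hmul`.
    have hexp2 (ω : Ω) : (S ω + Z k ω) ^ 2
        = S ω ^ 2 * Z k ω ^ 0 + 2 * (S ω ^ 1 * Z k ω ^ 1) + S ω ^ 0 * Z k ω ^ 2 := by ring
    have hexp4 (ω : Ω) : (S ω + Z k ω) ^ 4
        = S ω ^ 4 * Z k ω ^ 0 + 4 * (S ω ^ 3 * Z k ω ^ 1) + 6 * (S ω ^ 2 * Z k ω ^ 2)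
          + 4 * (S ω ^ 1 * Z k ω ^ 3) + S ω ^ 0 * Z k ω ^ 4 := by ring
    simp_rw [Finset.sum_range_succ, ← show ∀ ω, S ω = ∑ i ∈ Finset.range k, Z i ω from fun _ => rfl]
    constructor
    · simp_rw [hexp2]
      rw [integral_add ((hint 2 0).fun_add ((hint 1 1).const_mul 2)) (hint 0 2),
        integral_add (hint 2 0) ((hint 1 1).const_mul 2), integral_const_mul, hmul, hmul, hmul]
      simp only [pow_one, pow_zero, hS1, integral_const, probReal_univ, smul_eq_mul]
      push_cast
      linarith [ih.1, h2 k]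
    · simp_rw [hexp4]
      rw [integral_add ((((hint 4 0).fun_add ((hint 3 1).const_mul 4)).fun_add
          ((hint 2 2).const_mul 6)).fun_add ((hint 1 3).const_mul 4)) (hint 0 4),
        integral_add (((hint 4 0).fun_add ((hint 3 1).const_mul 4)).fun_add
          ((hint 2 2).const_mul 6)) ((hint 1 3).const_mul 4),
        integral_add ((hint 4 0).fun_add ((hint 3 1).const_mul 4)) ((hint 2 2).const_mul 6),
        integral_add (hint 4 0) ((hint 3 1).const_mul 4), integral_const_mul, integral_const_mul,
        integral_const_mul, hmul, hmul, hmul, hmul, hmul]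
      simp only [pow_one, pow_zero, hS1, h1, integral_const, probReal_univ, smul_eq_mul]
      -- Terms with a first power vanish by centring. The remaining cross term is at most `6 * k * s
      -- ^ 2`, which fits in the increment of `3 * k ^ 2 * s ^ 2`.
      have h22 := mul_le_mul ih.1 (h2 k) hZ20 (by positivity)
      push_cast
      nlinarith [ih.2, h4 k, sq_nonneg s]

/-- Truncation of a real number to `[-m, m]`. -/
noncomputable def clamp (m : ℕ) (y : ℝ) : ℝ := max (-m) (min y m)

lemma measurable_clamp (m : ℕ) : Measurable (clamp m) := by
  unfold clamp; fun_prop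

lemma abs_clamp (m : ℕ) (y : ℝ) : |clamp m y| = min |y| m := by
  have := Nat.cast_nonneg (α := ℝ) m
  unfold clamp
  grind

lemma clamp_eq_self {m : ℕ} {y : ℝ} (h : |y| ≤ m) : clamp m y = y := by
  unfold clamp
  grind

lemma clamp_pow_four (m : ℕ) (y : ℝ) : clamp m y ^ 4 = min |y| m ^ 4 := by
  rw [← abs_clamp, Even.pow_abs (by decide)]

lemma clamp_sq_le (m : ℕ) (y : ℝ) : clamp m y ^ 2 ≤ y ^ 2 := by
  rw [sq_le_sq, abs_clamp]; exact min_le_left _ _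

lemma abs_sub_clamp_le {m : ℕ} (hm : 1 ≤ m) (y : ℝ) : |y - clamp m y| ≤ y ^ 2 / m := by
  have hm' : (0 : ℝ) < m := by exact_mod_cast hm
  rcases le_or_gt |y| m with h | h
  · rw [clamp_eq_self h, sub_self, abs_zero]; positivity
  · have h1 : |y - clamp m y| ≤ |y| := by
      unfold clamp
      grind
    refine h1.trans ?_
    rw [le_div_iff₀ hm', ← sq_abs, sq]
    exact mul_le_mul_of_nonneg_left h.le (abs_nonneg _)

lemma natCast_pow_four_le_min (m : ℕ) (y : ℝ) (h : m < |y|) :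
    (m : ℝ) ^ 4 ≤ min |y| m ^ 4 := by
  rw [min_eq_right h.le]

variable {E Ω : Type*} [MeasurableSpace E] [MeasurableSpace Ω] {γ : Measure E} {P : Measure Ω}
  {Y : ℕ → Ω → E} {g : ℕ → E → ℝ}

lemma integral_comp_law (hYm : ∀ i, Measurable (Y i)) (hYlaw : ∀ i, P.map (Y i) = γ) (i : ℕ)
    {f : E → ℝ} (hf : Measurable f) : ∫ ω, f (Y i ω) ∂P = ∫ x, f x ∂γ := by
  rw [← hYlaw i, integral_map (hYm i).aemeasurable hf.aestronglyMeasurable]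

variable [IsProbabilityMeasure γ]

/-- A union bound over `m` indices and Markov's inequality for the truncated fourth moment bound the
probability that truncation acts at stage `m` by the `m`-th term of `hs`; Borel–Cantelli concludes.
-/
lemma ae_eventually_clamp_eq (hYm : ∀ i, Measurable (Y i)) (hYlaw : ∀ i, P.map (Y i) = γ)
    (hg : ∀ m, Measurable (g m))
    (hs : Summable fun m : ℕ => (∫ x, min |g m x| m ^ 4 ∂γ) / (m : ℝ) ^ 3) :
    ∀ᵐ ω ∂P, ∀ᶠ m in atTop, ∀ i < m, clamp m (g m (Y i ω)) = g m (Y i ω) := by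
  set s : ℕ → Set Ω := fun m => ⋃ i ∈ Finset.range m, {ω | (m : ℝ) < |g m (Y i ω)|} with hsdef
  have hmeas (m : ℕ) : P (s m) ≤ ENNReal.ofReal ((∫ x, min |g m x| m ^ 4 ∂γ) / (m : ℝ) ^ 3) := by
    rcases Nat.eq_zero_or_pos m with rfl | hm
    · simp [hsdef]
    have hm' : (0 : ℝ) < m := by exact_mod_cast hm
    have hset : MeasurableSet {x | (m : ℝ) < |g m x|} :=
      measurableSet_lt measurable_const (hg m).abs
    have h1 (i : ℕ) : P {ω | (m : ℝ) < |g m (Y i ω)|} = γ {x | (m : ℝ) < |g m x|} := by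
      rw [← hYlaw i, Measure.map_apply (hYm i) hset]; rfl
    have hint : Integrable (fun x => min |g m x| (m : ℝ) ^ 4) γ := by
      refine Integrable.of_bound
        (((hg m).abs.min measurable_const).pow_const 4).aestronglyMeasurable ((m : ℝ) ^ 4)
        (ae_of_all _ fun x => ?_)
      rw [Real.norm_of_nonneg (by positivity)]
      exact pow_le_pow_left₀ (by positivity) (min_le_right _ _) 4
    have h2 : (m : ℝ) ^ 4 * γ.real {x | (m : ℝ) < |g m x|} ≤ ∫ x, min |g m x| m ^ 4 ∂γ := by
      refine le_trans ?_ (mul_meas_ge_le_integral_of_nonneg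
        (ae_of_all _ fun x => by positivity) hint ((m : ℝ) ^ 4))
      refine mul_le_mul_of_nonneg_left (measureReal_mono fun x hx => ?_) (by positivity)
      exact natCast_pow_four_le_min m _ hx
    calc P (s m) ≤ ∑ i ∈ Finset.range m, P {ω | (m : ℝ) < |g m (Y i ω)|} :=
          measure_biUnion_finset_le _ _
      _ = m * γ {x | (m : ℝ) < |g m x|} := by simp [h1]
      _ = ENNReal.ofReal (m * γ.real {x | (m : ℝ) < |g m x|}) := by
          rw [ENNReal.ofReal_mul hm'.le, ENNReal.ofReal_natCast, ofReal_measureReal]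
      _ ≤ _ := by
          refine ENNReal.ofReal_le_ofReal ?_
          rw [le_div_iff₀ (by positivity)]
          linarith
  have h := measure_setOfPred_frequently_eq_zero (μ := P) (p := fun m ω => ω ∈ s m)
    (ne_top_of_le_ne_top hs.tsum_ofReal_ne_top (ENNReal.tsum_le_tsum hmeas))
  filter_upwards [measure_eq_zero_iff_ae_notMem.1 h] with ω hω
  filter_upwards [not_frequently.1 hω] with m hm i hi
  refine clamp_eq_self ?_
  by_contra! hlt
  exact hm (Set.mem_biUnion (Finset.mem_range.2 hi) hlt)

variable [IsProbabilityMeasure P]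

/-- The fourth moment of the centred average is at most `16` times the `m`-th term of `hs` plus `3 *
C ^ 2 / m ^ 2`, which is summable. No relation between different stages `m` is needed. -/
lemma ae_tendsto_average_clamp_sub (hYm : ∀ i, Measurable (Y i)) (hYlaw : ∀ i, P.map (Y i) = γ)
    (hY : iIndepFun Y P) (hg : ∀ m, Measurable (g m)) (hg2 : ∀ m, MemLp (g m) 2 γ) {C : ℝ}
    (hC : ∀ m, ∫ x, g m x ^ 2 ∂γ ≤ C)
    (hs : Summable fun m : ℕ => (∫ x, min |g m x| m ^ 4 ∂γ) / (m : ℝ) ^ 3) :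
    ∀ᵐ ω ∂P, Tendsto (fun m : ℕ => (m : ℝ)⁻¹ * ∑ i ∈ Finset.range m,
      (clamp m (g m (Y i ω)) - ∫ x, clamp m (g m x) ∂γ)) atTop (𝓝 0) := by
  set f : ℕ → E → ℝ := fun m x => clamp m (g m x) with hf
  have hfm (m : ℕ) : Measurable (f m) := (measurable_clamp m).comp (hg m)
  have hfb (m : ℕ) (x : E) : ‖f m x‖ ≤ m := by
    rw [Real.norm_eq_abs, hf, abs_clamp]; exact min_le_right _ _
  have hfp (m a : ℕ) : Integrable (fun x => f m x ^ a) γ :=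
    Integrable.of_bound ((hfm m).pow_const a).aestronglyMeasurable ((m : ℝ) ^ a)
      (ae_of_all _ fun x => by
        rw [norm_pow]; exact pow_le_pow_left₀ (norm_nonneg _) (hfb m x) a)
  have hfi (m : ℕ) : Integrable (f m) γ := by simpa using hfp m 1
  set c : ℕ → ℝ := fun m => ∫ x, f m x ∂γ with hc
  have hcb (m : ℕ) : |c m| ≤ m := by
    simpa using norm_integral_le_of_norm_le_const (ae_of_all γ (hfb m))
  set Z : ℕ → ℕ → Ω → ℝ := fun m i ω => f m (Y i ω) - c m with hZ
  have hZm (m i : ℕ) : Measurable (Z m i) := ((hfm m).comp (hYm i)).sub_const _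
  have hZb (m i : ℕ) (ω : Ω) : |Z m i ω| ≤ 2 * m := by
    have h1 := hfb m (Y i ω)
    rw [Real.norm_eq_abs] at h1
    linarith [abs_sub (f m (Y i ω)) (c m), hcb m]
  have hsub (m a : ℕ) : ∀ i, ∫ ω, Z m i ω ^ a ∂P = ∫ x, (f m x - c m) ^ a ∂γ := fun i =>
    integral_comp_law (f := fun x => (f m x - c m) ^ a) hYm hYlaw i
      (((hfm m).sub_const _).pow_const a)
  have hZ1 (m i : ℕ) : ∫ ω, Z m i ω ∂P = 0 := by
    have := hsub m 1 i
    simp only [pow_one] at this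
    rw [this, integral_sub (hfi m) (integrable_const _)]
    simp [hc]
  have hsqi (m : ℕ) : c m ^ 2 ≤ ∫ x, f m x ^ 2 ∂γ := by
    have h1 := variance_nonneg (f m) γ
    rw [variance_eq_sub ((memLp_two_iff_integrable_sq (hfm m).aestronglyMeasurable).2 (hfp m 2))]
      at h1
    simpa using h1
  have hf2 (m : ℕ) : ∫ x, f m x ^ 2 ∂γ ≤ C :=
    (integral_mono (hfp m 2) (hg2 m).integrable_sq fun x => clamp_sq_le m (g m x)).trans (hC m)
  have hZ2 (m i : ℕ) : ∫ ω, Z m i ω ^ 2 ∂P ≤ C := by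
    rw [hsub]
    have h1 : ∫ x, (f m x - c m) ^ 2 ∂γ = ∫ x, f m x ^ 2 ∂γ - c m ^ 2 := by
      have : ∀ x, (f m x - c m) ^ 2 = f m x ^ 2 - 2 * c m * f m x + c m ^ 2 := fun x => by ring
      simp_rw [this]
      rw [integral_add (f := fun x => f m x ^ 2 - 2 * c m * f m x)
        ((hfp m 2).sub ((hfi m).const_mul _)) (integrable_const _),
        integral_sub (hfp m 2) ((hfi m).const_mul _), integral_const_mul]
      simp only [integral_const, probReal_univ, smul_eq_mul]
      change _ - 2 * c m * c m + _ = _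
      ring
    nlinarith [hf2 m, sq_nonneg (c m)]
  have hc4 (m : ℕ) : c m ^ 4 ≤ ∫ x, f m x ^ 4 ∂γ := by
    have h1 : (∫ x, f m x ^ 2 ∂γ) ^ 2 ≤ ∫ x, f m x ^ 4 ∂γ := by
      have h1 := variance_nonneg (fun x => f m x ^ 2) γ
      have h3 (x : E) : (f m x ^ 2) ^ 2 = f m x ^ 4 := by ring
      rw [variance_eq_sub ((memLp_two_iff_integrable_sq
        ((hfm m).pow_const 2).aestronglyMeasurable).2 (by simpa only [h3] using hfp m 4))] at h1
      simpa only [Pi.pow_apply, h3, sub_nonneg] using h1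
    nlinarith [hsqi m, sq_nonneg (c m)]
  -- Here `16 = 8 + 8`, from `(a - c) ^ 4 ≤ 8 * a ^ 4 + 8 * c ^ 4` and Jensen's bound `hc4` on the
  -- mean.
  have hZ4 (m i : ℕ) : ∫ ω, Z m i ω ^ 4 ∂P ≤ 16 * ∫ x, min |g m x| m ^ 4 ∂γ := by
    rw [hsub]
    have h1 : ∫ x, (f m x - c m) ^ 4 ∂γ ≤ ∫ x, (8 * f m x ^ 4 + 8 * c m ^ 4) ∂γ := by
      refine integral_mono_of_nonneg (ae_of_all _ fun x => by positivity)
        (((hfp m 4).const_mul 8).add (integrable_const _)) (ae_of_all _ fun x => ?_)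
      nlinarith [sq_nonneg (f m x ^ 2 - c m ^ 2), sq_nonneg (f m x + c m),
        sq_nonneg ((f m x + c m) ^ 2), sq_nonneg (f m x - c m),
        mul_nonneg (sq_nonneg (f m x + c m)) (sq_nonneg (f m x - c m)),
        mul_nonneg (sq_nonneg (f m x + c m)) (sq_nonneg (f m x)),
        mul_nonneg (sq_nonneg (f m x + c m)) (sq_nonneg (c m))]
    rw [integral_add ((hfp m 4).const_mul 8) (integrable_const _), integral_const_mul] at h1
    simp only [integral_const, probReal_univ, smul_eq_mul, one_mul] at h1
    have h2 : ∫ x, f m x ^ 4 ∂γ = ∫ x, min |g m x| m ^ 4 ∂γ := by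
      simp_rw [hf, clamp_pow_four]
    linarith [hc4 m]
  set F : ℕ → Ω → ℝ := fun m ω => ((m : ℝ)⁻¹ * ∑ i ∈ Finset.range m, Z m i ω) ^ 4 with hF
  have hFi (m : ℕ) : Integrable (F m) P := by
    refine Integrable.of_bound (((Finset.measurable_fun_sum _ fun i _ =>
      hZm m i).const_mul _).pow_const 4).aestronglyMeasurable
      (((m : ℝ)⁻¹ * (m * (2 * m))) ^ 4) (ae_of_all _ fun ω => ?_)
    rw [hF, norm_pow, norm_mul, norm_inv, Real.norm_natCast]
    refine pow_le_pow_left₀ (by positivity) (mul_le_mul_of_nonneg_left ?_ (by positivity)) 4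
    refine (Finset.abs_sum_le_sum_abs _ _).trans ?_
    exact (Finset.sum_le_sum fun i _ => hZb m i ω).trans (by simp)
  have hFs : Summable fun m => ∫ ω, F m ω ∂P := by
    refine Summable.of_nonneg_of_le (fun m => integral_nonneg fun ω => by positivity)
      (fun m => ?_) ((hs.mul_left 16).add
        ((Real.summable_one_div_nat_pow.2 one_lt_two).mul_left (3 * C ^ 2)))
    rcases Nat.eq_zero_or_pos m with rfl | hm
    · simp [hF]
    have hm' : (0 : ℝ) < m := by exact_mod_cast hm
    have hind : iIndepFun (Z m) P :=
      hY.comp (fun _ x => f m x - c m) fun _ => (hfm m).sub_const _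
    have h4 := (integral_sum_pow_le (hZm m) hind (hZb m) (hZ1 m) (hZ2 m) (hZ4 m) m).2
    simp_rw [hF, mul_pow]
    rw [integral_const_mul, inv_pow, inv_mul_le_iff₀ (by positivity)]
    refine h4.trans (le_of_eq ?_)
    field_simp
  filter_upwards [ae_tendsto_zero_of_summable_integral hFi (fun m ω => by positivity) hFs]
    with ω hω
  have h1 := (hω.sqrt).sqrt
  rw [Real.sqrt_zero, Real.sqrt_zero] at h1
  refine (tendsto_zero_iff_abs_tendsto_zero _).2 (h1.congr fun m => ?_)
  rw [hF]
  simp only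
  rw [show ∀ y : ℝ, y ^ 4 = (y ^ 2) ^ 2 from fun y => by ring, Real.sqrt_sq (sq_nonneg _),
    Real.sqrt_sq_eq_abs]
  rfl

/-- A **Hsu-Robbins type strong law** for the averages of a triangular array obtained by applying
varying functions to a single i.i.d. sequence. -/
theorem ae_tendsto_average_sub_integral (hYm : ∀ i, Measurable (Y i))
    (hYlaw : ∀ i, P.map (Y i) = γ) (hY : iIndepFun Y P) (hg : ∀ m, Measurable (g m))
    (hg2 : ∀ m, MemLp (g m) 2 γ) {C : ℝ} (hC : ∀ m, ∫ x, g m x ^ 2 ∂γ ≤ C)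
    (hs : Summable fun m : ℕ => (∫ x, min |g m x| m ^ 4 ∂γ) / (m : ℝ) ^ 3) :
    ∀ᵐ ω ∂P, Tendsto (fun m : ℕ => (m : ℝ)⁻¹ * ∑ i ∈ Finset.range m, g m (Y i ω)
      - ∫ x, g m x ∂γ) atTop (𝓝 0) := by
  -- Truncation at `m` moves `y` by at most `y ^ 2 / m`, so the bias is at most `C / m`.
  have hbias : Tendsto (fun m : ℕ => ∫ x, g m x ∂γ - ∫ x, clamp m (g m x) ∂γ) atTop (𝓝 0) := by
    refine squeeze_zero_norm' ?_ (tendsto_const_div_atTop_nhds_zero_nat C)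
    filter_upwards [eventually_ge_atTop 1] with m hm
    have hci : Integrable (fun x => clamp m (g m x)) γ :=
      Integrable.of_bound ((measurable_clamp m).comp (hg m)).aestronglyMeasurable (m : ℝ)
        (ae_of_all _ fun x => by rw [Real.norm_eq_abs, abs_clamp]; exact min_le_right _ _)
    rw [← integral_sub ((hg2 m).integrable (by norm_num)) hci]
    refine (norm_integral_le_of_norm_le ((hg2 m).integrable_sq.div_const (m : ℝ))
      (ae_of_all _ fun x => abs_sub_clamp_le hm (g m x))).trans ?_
    rw [integral_div]
    gcongr
    exact hC m
  filter_upwards [ae_tendsto_average_clamp_sub hYm hYlaw hY hg hg2 hC hs,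
    ae_eventually_clamp_eq hYm hYlaw hg hs] with ω h1 h2
  have h3 := h1.sub hbias
  rw [sub_zero] at h3
  refine h3.congr' ?_
  filter_upwards [h2, eventually_ge_atTop 1] with m hm hm1
  have hm' : (m : ℝ) ≠ 0 := by positivity
  rw [Finset.sum_congr rfl fun i hi => by rw [hm i (Finset.mem_range.1 hi)],
    Finset.sum_sub_distrib, Finset.sum_const, Finset.card_range, nsmul_eq_mul]
  field_simp
  ring

end CompleteConvergence

/-! ### Summability of truncated moments and the strong law for deterministic parameters. -/

section Arrays

variable {d : ℕ} {φ : Vec d → ℝ}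

/-- The right-hand side is a telescoping majorant: its increment dominates the new term both for `h
≤ N + 1` and for `N + 1 ≤ h`. Unlike the constant bound `4 * h ^ 2`, it carries an induction. -/
lemma sum_min_pow_four_div_le {h : ℝ} (hh : 0 < h) (N : ℕ) :
    ∑ m ∈ Finset.range (N + 1), min h m ^ 4 / (m : ℝ) ^ 3
      ≤ 4 * h ^ 2 * ((N : ℝ) ^ 2 / ((N : ℝ) ^ 2 + h ^ 2)) := by
  induction N with
  | zero => simp
  | succ N ih =>
    rw [Finset.sum_range_succ]
    have key : min h ((N + 1 : ℕ) : ℝ) ^ 4 / ((N + 1 : ℕ) : ℝ) ^ 3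
        ≤ 4 * h ^ 2 * (((N + 1 : ℕ) : ℝ) ^ 2 / (((N + 1 : ℕ) : ℝ) ^ 2 + h ^ 2))
          - 4 * h ^ 2 * ((N : ℝ) ^ 2 / ((N : ℝ) ^ 2 + h ^ 2)) := by
      have hN : (0 : ℝ) ≤ N := N.cast_nonneg
      push_cast
      have h1 : 4 * h ^ 2 * (((N : ℝ) + 1) ^ 2 / (((N : ℝ) + 1) ^ 2 + h ^ 2))
          - 4 * h ^ 2 * ((N : ℝ) ^ 2 / ((N : ℝ) ^ 2 + h ^ 2))
          = 4 * h ^ 4 * (2 * N + 1) / ((((N : ℝ) + 1) ^ 2 + h ^ 2) * ((N : ℝ) ^ 2 + h ^ 2)) := by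
        field_simp
        ring
      rw [h1, div_le_div_iff₀ (by positivity) (by positivity)]
      rcases le_total h ((N : ℝ) + 1) with hc | hc
      · rw [min_eq_left hc]
        have h2 : h ^ 2 ≤ ((N : ℝ) + 1) ^ 2 := pow_le_pow_left₀ hh.le hc 2
        have h3 : (((N : ℝ) + 1) ^ 2 + h ^ 2) * ((N : ℝ) ^ 2 + h ^ 2)
            ≤ (2 * ((N : ℝ) + 1) ^ 2) * (2 * ((N : ℝ) + 1) ^ 2) :=
          mul_le_mul (by linarith) (by nlinarith) (by positivity) (by positivity)
        have h4 : (2 * ((N : ℝ) + 1) ^ 2) * (2 * ((N : ℝ) + 1) ^ 2)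
            ≤ 4 * (2 * N + 1) * ((N : ℝ) + 1) ^ 3 := by
          have : (0 : ℝ) ≤ ((N : ℝ) + 1) ^ 3 * N := by positivity
          nlinarith
        calc _ ≤ h ^ 4 * (4 * (2 * N + 1) * ((N : ℝ) + 1) ^ 3) :=
              mul_le_mul_of_nonneg_left (h3.trans h4) (by positivity)
          _ = _ := by ring
      · rw [min_eq_right hc]
        have h2 : ((N : ℝ) + 1) ^ 2 ≤ h ^ 2 := pow_le_pow_left₀ (by positivity) hc 2
        have h3 : (((N : ℝ) + 1) ^ 2 + h ^ 2) * ((N : ℝ) ^ 2 + h ^ 2)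
            ≤ (2 * h ^ 2) * (2 * h ^ 2) :=
          mul_le_mul (by linarith) (by nlinarith) (by positivity) (by positivity)
        calc _ ≤ ((N : ℝ) + 1) ^ 4 * ((2 * h ^ 2) * (2 * h ^ 2)) :=
              mul_le_mul_of_nonneg_left h3 (by positivity)
          _ = 4 * h ^ 4 * (N + 1) * ((N : ℝ) + 1) ^ 3 := by ring
          _ ≤ 4 * h ^ 4 * (2 * N + 1) * ((N : ℝ) + 1) ^ 3 := by gcongr; linarith
    linarith

lemma sum_min_pow_four_div_le_sq {h : ℝ} (hh : 0 ≤ h) (N : ℕ) :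
    ∑ m ∈ Finset.range N, min h m ^ 4 / (m : ℝ) ^ 3 ≤ 4 * h ^ 2 := by
  rcases hh.eq_or_lt with rfl | hh
  · refine (Finset.sum_eq_zero fun m _ => ?_).le.trans (by positivity)
    rw [min_eq_left m.cast_nonneg]; simp
  rcases Nat.eq_zero_or_pos N with rfl | hN
  · simp; positivity
  obtain ⟨N, rfl⟩ := Nat.exists_eq_add_of_le' hN
  refine (sum_min_pow_four_div_le hh N).trans (mul_le_of_le_one_right (by positivity) ?_)
  rw [div_le_one (by positivity)]
  linarith [sq_nonneg h]

/-- After the translation is undone, all terms are integrals against one Gaussian law with one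
envelope. The sum can then be taken inside the integral, where `sum_min_pow_four_div_le_sq` turns
truncated fourth powers into a square. -/
lemma TiltIntegrable.summable_truncated_moments (h : TiltIntegrable φ) (hφ : Measurable φ)
    {a : ℕ → Vec d} {M : ℝ} (ha : ∀ m, ‖a m‖ ≤ M) :
    Summable fun m : ℕ => (∫ x, min |shifted φ (a m) x| m ^ 4 ∂(gauss d)) / (m : ℝ) ^ 3 := by
  have hmeas (m : ℕ) (M : ℝ) : Measurable fun x => min (envelope φ M x) (m : ℝ) ^ 4 := by
    unfold envelope; fun_prop
  have hle (m : ℕ) (x : Vec d) : min (envelope φ M x) (m : ℝ) ^ 4 ≤ (m : ℝ) ^ 4 :=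
    pow_le_pow_left₀ (le_min (envelope_nonneg φ M x) m.cast_nonneg) (min_le_right _ _) 4
  have h1 := integrable_exp_norm (d := d) M
  have hint (m : ℕ) : Integrable
      (fun x => Real.exp (M * ‖x‖) * (min (envelope φ M x) (m : ℝ) ^ 4 / (m : ℝ) ^ 3))
      (gauss d) := by
    refine h1.mul_bdd (c := (m : ℝ) ^ 4 / (m : ℝ) ^ 3)
      ((hmeas m M).div_const _).aestronglyMeasurable (ae_of_all _ fun x => ?_)
    rw [Real.norm_of_nonneg (by positivity)]
    exact div_le_div_of_nonneg_right (hle m x) (by positivity)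
  refine summable_of_sum_range_le (c := ∫ x, Real.exp (M * ‖x‖) * (4 * envelope φ M x ^ 2)
    ∂(gauss d)) (fun m => ?_) fun N => ?_
  · exact div_nonneg (integral_nonneg fun x => by positivity) (by positivity)
  calc _ ≤ ∑ m ∈ Finset.range N, ∫ x, Real.exp (M * ‖x‖) *
        (min (envelope φ M x) (m : ℝ) ^ 4 / (m : ℝ) ^ 3) ∂(gauss d) := by
        refine Finset.sum_le_sum fun m _ => ?_
        rw [integral_comp_shifted (a m) fun y : ℝ => min |y| m ^ 4, ← integral_div]
        refine integral_mono_of_nonneg (ae_of_all _ fun x => ?_) (hint m)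
          (ae_of_all _ fun x => ?_)
        · have := (shiftDensity_pos (a m) x).le
          simp only [smul_eq_mul, Pi.zero_apply]; positivity
        · simp only [smul_eq_mul]
          rw [mul_div_assoc]
          have h2 : min |weighted φ (a m) x| (m : ℝ) ≤ min (envelope φ M x) (m : ℝ) :=
            min_le_min_right _ (abs_weighted_le (ha m) x)
          have h3 := shiftDensity_le (ha m) x
          gcongr
    _ = ∫ x, ∑ m ∈ Finset.range N, Real.exp (M * ‖x‖) *
        (min (envelope φ M x) (m : ℝ) ^ 4 / (m : ℝ) ^ 3) ∂(gauss d) :=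
        (integral_finsetSum _ fun m _ => hint m).symm
    _ ≤ _ := by
        refine integral_mono (integrable_finsetSum _ fun m _ => hint m) ?_ fun x => ?_
        · simpa only [mul_left_comm] using (h.envelope_sq hφ M).const_mul 4
        · rw [← Finset.mul_sum]
          exact mul_le_mul_of_nonneg_left
            (sum_min_pow_four_div_le_sq (envelope_nonneg φ M x) N) (Real.exp_pos _).le

lemma TiltIntegrable.v_le (h : TiltIntegrable φ) (hφ : Measurable φ) {M : ℝ} {θ : Vec d}
    (hθ : ‖θ‖ ≤ M) :
    v φ θ ≤ ∫ x, Real.exp (M ^ 2 / 2) * (φ x ^ 2 * Real.exp (M * ‖x‖)) ∂(gauss d) :=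
  integral_mono (h.criterion θ) ((h.exp_norm hφ M).const_mul _) fun x => criterion_le hθ x

variable {Ω : Type*} [MeasurableSpace Ω] {P : Measure Ω} [IsProbabilityMeasure P]
  {Y : ℕ → Ω → Vec d}

/-- The strong law for the estimator along a bounded deterministic sequence of parameters. -/
theorem TiltIntegrable.ae_tendsto_estimator (h : TiltIntegrable φ) (hφ : Measurable φ)
    (hYm : ∀ i, Measurable (Y i)) (hYlaw : ∀ i, P.map (Y i) = gauss d) (hY : iIndepFun Y P)
    {a : ℕ → Vec d} {M : ℝ} (ha : ∀ m, ‖a m‖ ≤ M) :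
    ∀ᵐ ω ∂P, Tendsto (fun m => estimator φ (fun i => Y i ω) m (a m)) atTop
      (𝓝 (∫ x, φ x ∂(gauss d))) := by
  filter_upwards [ae_tendsto_average_sub_integral hYm hYlaw hY
    (fun m => measurable_shifted hφ (a m)) (fun m => h.memLp_shifted hφ (a m))
    (fun m => (integral_shifted_sq φ (a m)).le.trans (h.v_le hφ (ha m)))
    (h.summable_truncated_moments hφ ha)] with ω hω
  simp_rw [integral_shifted] at hω
  simpa only [estimator, one_div] using tendsto_sub_nhds_zero_iff.1 hω

end Arrays

/-! ### Characteristic functions along convergent deterministic parameters. -/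

section CentralLimit

/-- The remainder of order two of `s ↦ exp(is)` at the origin. -/
noncomputable def expRemainder (s : ℝ) : ℂ := Complex.exp (s * Complex.I) - 1 - s * Complex.I

lemma continuous_expRemainder : Continuous expRemainder := by
  unfold expRemainder; fun_prop

/-- Taylor's estimate covers `|s| ≤ 1` and the triangle inequality the rest. Being global, the
quadratic bound provides the domination; `norm_expRemainder_add_le` provides the pointwise limit. -/
lemma norm_expRemainder_le (s : ℝ) : ‖expRemainder s‖ ≤ 3 * s ^ 2 := by
  have hn : ‖(s : ℂ) * Complex.I‖ = |s| := by simp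
  rcases le_or_gt |s| 1 with h1 | h1
  · have := Complex.norm_exp_sub_one_sub_id_le (x := s * Complex.I) (by rwa [hn])
    rw [hn, sq_abs] at this
    exact this.trans (by nlinarith [sq_nonneg s])
  · have h2 : ‖expRemainder s‖ ≤ 1 + 1 + |s| := by
      refine (norm_sub_le _ _).trans (add_le_add ((norm_sub_le _ _).trans ?_) hn.le)
      rw [Complex.norm_exp_ofReal_mul_I, norm_one]
    rw [← sq_abs]
    nlinarith

lemma norm_expRemainder_add_le (s : ℝ) :
    ‖expRemainder s + (s : ℂ) ^ 2 / 2‖ ≤ |s| ^ 3 * Real.exp |s| := by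
  have h := Complex.norm_exp_sub_sum_le_norm_mul_exp (s * Complex.I) 3
  have hn : ‖(s : ℂ) * Complex.I‖ = |s| := by simp
  rw [hn] at h
  refine le_trans (le_of_eq ?_) h
  congr 1
  simp only [expRemainder, Finset.sum_range_succ, Finset.sum_range_zero, Nat.factorial, mul_pow,
    Complex.I_sq]
  push_cast
  ring

lemma tendsto_mul_expRemainder {z : ℕ → ℝ} {z₀ : ℝ} (hz : Tendsto z atTop (𝓝 z₀)) :
    Tendsto (fun m : ℕ => (m : ℂ) * expRemainder (z m / √m)) atTop
      (𝓝 (-(z₀ : ℂ) ^ 2 / 2)) := by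
  have hsq : Tendsto (fun m : ℕ => (√(m : ℝ))⁻¹) atTop (𝓝 0) :=
    tendsto_inv_atTop_zero.comp (Real.tendsto_sqrt_atTop.comp tendsto_natCast_atTop_atTop)
  have h1 : Tendsto (fun m : ℕ => (m : ℂ) * expRemainder (z m / √m) + (z m : ℂ) ^ 2 / 2) atTop
      (𝓝 0) := by
    have hlim : Tendsto (fun m : ℕ => |z m| ^ 3 * (√(m : ℝ))⁻¹ * Real.exp (|z m| * (√(m : ℝ))⁻¹))
        atTop (𝓝 0) := by
      have := ((hz.abs.pow 3).mul hsq).mul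
        ((Real.continuous_exp.tendsto _).comp (hz.abs.mul hsq))
      simpa using this
    refine squeeze_zero_norm' ?_ hlim
    filter_upwards [eventually_ge_atTop 1] with m hm
    have hm' : (0 : ℝ) < m := by exact_mod_cast hm
    have hs : √(m : ℝ) ^ 2 = m := Real.sq_sqrt hm'.le
    have hs0 : 0 < √(m : ℝ) := Real.sqrt_pos.2 hm'
    have heq : (m : ℂ) * expRemainder (z m / √m) + (z m : ℂ) ^ 2 / 2
        = (m : ℂ) * (expRemainder (z m / √m) + ((z m / √m : ℝ) : ℂ) ^ 2 / 2) := by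
      have h1 : ((z m / √m : ℝ) : ℂ) ^ 2 = (z m : ℂ) ^ 2 / m := by
        rw [← Complex.ofReal_pow, div_pow, hs]
        push_cast
        rfl
      have : (m : ℂ) ≠ 0 := by exact_mod_cast hm'.ne'
      rw [mul_add, h1]
      field_simp
    rw [heq, norm_mul, Complex.norm_natCast]
    refine (mul_le_mul_of_nonneg_left (norm_expRemainder_add_le _) hm'.le).trans (le_of_eq ?_)
    rw [abs_div, abs_of_pos hs0, ← div_eq_mul_inv |z m|, div_pow]
    nth_rw 1 [← hs]
    field_simp
  have h2 : Tendsto (fun m : ℕ => (z m : ℂ) ^ 2 / 2) atTop (𝓝 ((z₀ : ℂ) ^ 2 / 2)) :=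
    ((Complex.continuous_ofReal.tendsto z₀).comp hz |>.pow 2).div_const 2
  have h3 := h1.sub h2
  simpa [neg_div] using h3

lemma integral_cexp_sum_eq_pow {E Ω : Type*} [MeasurableSpace E] [MeasurableSpace Ω]
    {γ : Measure E} {P : Measure Ω} [IsProbabilityMeasure P] {Y : ℕ → Ω → E}
    (hYm : ∀ i, Measurable (Y i)) (hYlaw : ∀ i, P.map (Y i) = γ) (hY : iIndepFun Y P)
    {f : E → ℝ} (hf : Measurable f) (m : ℕ) :
    ∫ ω, Complex.exp ((∑ i ∈ Finset.range m, f (Y i ω) : ℝ) * Complex.I) ∂P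
      = (∫ x, Complex.exp (f x * Complex.I) ∂γ) ^ m := by
  have hm (i : ℕ) : Measurable fun ω => f (Y i ω) := hf.comp (hYm i)
  have hind : iIndepFun (fun (i : Fin m) ω => f (Y i ω)) P :=
    (hY.comp (fun _ => f) fun _ => hf).precomp Fin.val_injective
  have h := congrFun (iIndepFun.charFun_map_fun_sum_eq_prod
    (fun i : Fin m => (hm i).aemeasurable) hind) 1
  have h1 (i : ℕ) : charFun (P.map fun ω => f (Y i ω)) 1
      = ∫ x, Complex.exp (f x * Complex.I) ∂γ := by
    rw [charFun_apply_real, integral_map (hm i).aemeasurable (by fun_prop), ← hYlaw i,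
      integral_map (hYm i).aemeasurable (by fun_prop)]
    simp
  rw [charFun_apply_real, integral_map (by fun_prop) (by fun_prop)] at h
  simp only [Finset.prod_apply, h1, Finset.prod_const, Finset.card_univ, Fintype.card_fin] at h
  rw [← h]
  simp [Finset.sum_range]

variable {d : ℕ} {φ : Vec d → ℝ}

lemma TiltIntegrable.tendsto_mul_integral_cexp_sub_one (h : TiltIntegrable φ) (hφ : Measurable φ)
    {a : ℕ → Vec d} {θs : Vec d} (ha : Tendsto a atTop (𝓝 θs)) (t : ℝ) :
    Tendsto (fun m : ℕ => (m : ℂ) * (∫ x, Complex.exp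
      ((t * (shifted φ (a m) x - ∫ x, φ x ∂(gauss d)) / √m : ℝ) * Complex.I) ∂(gauss d) - 1))
      atTop (𝓝 (-(t : ℂ) ^ 2 * (v φ θs - (∫ x, φ x ∂(gauss d)) ^ 2 : ℝ) / 2)) := by
  set c := ∫ x, φ x ∂(gauss d) with hc
  obtain ⟨M, hM⟩ : ∃ M, ∀ m, ‖a m‖ ≤ M := by
    obtain ⟨M, hM⟩ := ha.norm.bddAbove_range
    exact ⟨M, fun m => hM ⟨m, rfl⟩⟩
  -- Unbiasedness at every parameter kills the linear term, so only the second-order remainder is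
  -- integrated.
  have hcenter (m : ℕ) : ∫ x, Complex.exp
      ((t * (shifted φ (a m) x - c) / √m : ℝ) * Complex.I) ∂(gauss d) - 1
      = ∫ x, expRemainder (t * (shifted φ (a m) x - c) / √m) ∂(gauss d) := by
    have hsm := measurable_shifted hφ (a m)
    have hi : Integrable (fun x => t * (shifted φ (a m) x - c) / √m) (gauss d) :=
      (((h.integrable_shifted hφ (a m)).sub (integrable_const c)).const_mul t).div_const _
    have hi0 : ∫ x, t * (shifted φ (a m) x - c) / √m ∂(gauss d) = 0 := by
      rw [integral_div, integral_const_mul, integral_sub (h.integrable_shifted hφ (a m))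
        (integrable_const c), integral_shifted]
      simp [hc]
    have hi' : Integrable (fun x => ((t * (shifted φ (a m) x - c) / √m : ℝ) : ℂ)) (gauss d) :=
      hi.ofReal
    have he : Integrable (fun x => Complex.exp
        ((t * (shifted φ (a m) x - c) / √m : ℝ) * Complex.I)) (gauss d) :=
      Integrable.of_bound (by fun_prop) 1
        (ae_of_all _ fun x => (Complex.norm_exp_ofReal_mul_I _).le)
    unfold expRemainder
    rw [integral_sub (f := fun x => Complex.exp
        ((t * (shifted φ (a m) x - c) / √m : ℝ) * Complex.I) - 1)
        (he.sub (integrable_const 1)) (hi'.mul_const _),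
      integral_sub he (integrable_const 1), integral_mul_const, integral_complex_ofReal, hi0]
    simp
  simp_rw [hcenter]
  have hvar : (-(t : ℂ) ^ 2 * (v φ θs - c ^ 2 : ℝ) / 2)
      = ∫ x, shiftDensity θs x • (-((t * (weighted φ θs x - c) : ℝ) : ℂ) ^ 2 / 2) ∂(gauss d) := by
    rw [← integral_comp_shifted θs fun y : ℝ => (-((t * (y - c) : ℝ) : ℂ) ^ 2 / 2)]
    have h1 (x : Vec d) : (-((t * (shifted φ θs x - c) : ℝ) : ℂ) ^ 2 / 2)
        = (-(t : ℂ) ^ 2 / 2) * (((shifted φ θs x - c) ^ 2 : ℝ) : ℂ) := by push_cast; ring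
    simp_rw [h1]
    rw [integral_const_mul, integral_complex_ofReal, ← h.variance_shifted hφ θs,
      variance_eq_integral (measurable_shifted hφ θs).aemeasurable, integral_shifted]
    ring
  rw [hvar]
  -- Once unshifted, the integrand depends on `a m` through continuous exponentials only, so it
  -- converges pointwise.
  have hcov (m : ℕ) : (m : ℂ) * ∫ x, expRemainder (t * (shifted φ (a m) x - c) / √m) ∂(gauss d)
      = ∫ x, shiftDensity (a m) x •
        ((m : ℂ) * expRemainder (t * (weighted φ (a m) x - c) / √m)) ∂(gauss d) := by
    rw [← integral_const_mul]
    exact integral_comp_shifted (a m) fun y : ℝ =>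
      (m : ℂ) * expRemainder (t * (y - c) / √m)
  simp_rw [hcov]
  have h1 := integrable_exp_norm (d := d) M
  refine tendsto_integral_of_dominated_convergence
    (fun x => 6 * t ^ 2 * (Real.exp (M * ‖x‖) * envelope φ M x ^ 2)
      + 6 * t ^ 2 * c ^ 2 * Real.exp (M * ‖x‖)) (fun m => ?_)
    (((h.envelope_sq hφ M).const_mul _).add (h1.const_mul _)) (fun m => ae_of_all _ fun x => ?_)
    (ae_of_all _ fun x => ?_)
  · have h1 := measurable_shiftDensity (a m)
    have h2 := measurable_weighted hφ (a m)
    have h3 := continuous_expRemainder.measurable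
    exact Measurable.aestronglyMeasurable (by fun_prop)
  · rw [norm_smul, Real.norm_of_nonneg (shiftDensity_pos _ _).le]
    have h2 : ‖(m : ℂ) * expRemainder (t * (weighted φ (a m) x - c) / √m)‖
        ≤ 6 * t ^ 2 * (envelope φ M x ^ 2 + c ^ 2) := by
      rw [norm_mul, Complex.norm_natCast]
      rcases Nat.eq_zero_or_pos m with rfl | hm
      · simp; positivity
      have hm' : (0 : ℝ) < m := by exact_mod_cast hm
      refine (mul_le_mul_of_nonneg_left (norm_expRemainder_le _) hm'.le).trans ?_
      rw [div_pow, Real.sq_sqrt hm'.le]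
      have h4 : weighted φ (a m) x ^ 2 ≤ envelope φ M x ^ 2 :=
        sq_le_sq' (by linarith [neg_le_of_abs_le (abs_weighted_le (φ := φ) (hM m) x)])
          (le_of_abs_le (abs_weighted_le (hM m) x))
      have h5 : (m : ℝ) * (3 * ((t * (weighted φ (a m) x - c)) ^ 2 / m))
          = 3 * t ^ 2 * (weighted φ (a m) x - c) ^ 2 := by field_simp
      rw [h5]
      have h6 : (weighted φ (a m) x - c) ^ 2 ≤ 2 * (envelope φ M x ^ 2 + c ^ 2) := by
        nlinarith [sq_nonneg (weighted φ (a m) x + c)]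
      nlinarith [mul_le_mul_of_nonneg_left h6 (by positivity : 0 ≤ 3 * t ^ 2)]
    refine (mul_le_mul (shiftDensity_le (hM m) x) h2 (norm_nonneg _)
      (Real.exp_pos _).le).trans (le_of_eq (by ring))
  · have hd : Tendsto (fun m => shiftDensity (a m) x) atTop (𝓝 (shiftDensity θs x)) := by
      have : Continuous fun θ : Vec d => shiftDensity θ x := by unfold shiftDensity; fun_prop
      exact (this.tendsto θs).comp ha
    have hw : Tendsto (fun m => t * (weighted φ (a m) x - c)) atTop
        (𝓝 (t * (weighted φ θs x - c))) := by
      have : Continuous fun θ : Vec d => t * (weighted φ θ x - c) := by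
        unfold weighted; fun_prop
      exact (this.tendsto θs).comp ha
    exact hd.smul (tendsto_mul_expRemainder hw)

/-- The central limit theorem for the estimator along a convergent deterministic sequence of
parameters, in terms of characteristic functions. -/
theorem TiltIntegrable.tendsto_integral_cexp_estimator (h : TiltIntegrable φ) (hφ : Measurable φ)
    {Ω : Type*} [MeasurableSpace Ω] {P : Measure Ω} [IsProbabilityMeasure P] {Y : ℕ → Ω → Vec d}
    (hYm : ∀ i, Measurable (Y i)) (hYlaw : ∀ i, P.map (Y i) = gauss d) (hY : iIndepFun Y P)
    {a : ℕ → Vec d} {θs : Vec d} (ha : Tendsto a atTop (𝓝 θs)) (t : ℝ) :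
    Tendsto (fun m : ℕ => ∫ ω, Complex.exp (t * (√m * (estimator φ (fun i => Y i ω) m (a m)
      - ∫ x, φ x ∂(gauss d)) : ℝ) * Complex.I) ∂P) atTop
      (𝓝 (Complex.exp (-(t : ℂ) ^ 2 * (v φ θs - (∫ x, φ x ∂(gauss d)) ^ 2 : ℝ) / 2))) := by
  -- The characteristic function of the sum is an `m`-th power `(1 + z m) ^ m`, where `m * z m`
  -- converges by the preceding lemma.
  refine (Complex.tendsto_one_add_pow_exp_of_tendsto
    (h.tendsto_mul_integral_cexp_sub_one hφ ha t)).congr' ?_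
  filter_upwards [eventually_ge_atTop 1] with m hm
  have hm' : (0 : ℝ) < m := by exact_mod_cast hm
  have hsm := measurable_shifted hφ (a m)
  rw [add_sub_cancel, ← integral_cexp_sum_eq_pow hYm hYlaw hY (by fun_prop)]
  refine integral_congr_ae (ae_of_all _ fun ω => ?_)
  simp only [← Complex.ofReal_mul]
  congr 3
  rw [← Finset.sum_div, ← Finset.mul_sum, Finset.sum_sub_distrib, estimator, Finset.sum_const,
    Finset.card_range, nsmul_eq_mul, div_eq_iff (Real.sqrt_pos.2 hm').ne']
  have hs : √(m : ℝ) * √(m : ℝ) = m := Real.mul_self_sqrt hm'.le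
  calc _ = t * ((m : ℝ) * ((1 / m) * ∑ i ∈ Finset.range m, shifted φ (a m) (Y i ω)
        - ∫ x, φ x ∂(gauss d))) := by field_simp
    _ = t * ((√(m : ℝ) * √(m : ℝ)) * ((1 / m) * ∑ i ∈ Finset.range m, shifted φ (a m) (Y i ω)
        - ∫ x, φ x ∂(gauss d))) := by rw [hs]
    _ = _ := by ring

end CentralLimit

/-! ### Freezing one of two independent variables. -/

section Transfer

variable {Ω S U : Type*} [MeasurableSpace Ω] [MeasurableSpace S] [MeasurableSpace U]
  {P : Measure Ω} [IsProbabilityMeasure P] {A : Ω → S} {B : Ω → U}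

/-- The joint law of two independent variables is that of two copies on a product space. -/
lemma map_prodMk_eq_map_prod (hA : Measurable A) (hB : Measurable B) (h : IndepFun A B P) :
    P.map (fun ω => (A ω, B ω)) = (P.prod P).map fun p => (A p.1, B p.2) := by
  rw [(indepFun_iff_map_prod_eq_prod_map_map hA.aemeasurable hB.aemeasurable).1 h,
    Measure.map_prod_map P P hA hB]
  rfl

/-- Independence replaces the pair by two copies on `P.prod P`, where Fubini applies. Duplicating
`Ω` keeps each fibre statement about the original `B` under `P`. -/
lemma ae_of_ae_ae_of_indepFun (hA : Measurable A) (hB : Measurable B) (h : IndepFun A B P)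
    {s : Set (S × U)} (hs : MeasurableSet s) (hae : ∀ᵐ ω ∂P, ∀ᵐ ω' ∂P, (A ω, B ω') ∈ s) :
    ∀ᵐ ω ∂P, (A ω, B ω) ∈ s := by
  have hm : Measurable fun p : Ω × Ω => (A p.1, B p.2) := by fun_prop
  have h1 : ∀ᵐ p ∂(P.prod P), (A p.1, B p.2) ∈ s :=
    (Measure.ae_prod_mem_iff_ae_ae_mem (hm hs)).2 hae
  have h2 := (ae_map_iff (p := (· ∈ s)) hm.aemeasurable hs).2 h1
  rw [← map_prodMk_eq_map_prod hA hB h] at h2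
  exact (ae_map_iff (p := (· ∈ s)) (by fun_prop) hs).1 h2

lemma integrable_iff_of_indepFun {F : Type*} [NormedAddCommGroup F]
    (hA : Measurable A) (hB : Measurable B) (h : IndepFun A B P) {f : S × U → F}
    (hf : StronglyMeasurable f) :
    Integrable (fun ω => f (A ω, B ω)) P
      ↔ Integrable (fun p : Ω × Ω => f (A p.1, B p.2)) (P.prod P) := by
  have hm : Measurable fun p : Ω × Ω => (A p.1, B p.2) := by fun_prop
  have h1 := integrable_map_measure (μ := P) (f := fun ω => (A ω, B ω))
    hf.aestronglyMeasurable (by fun_prop)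
  have h2 := integrable_map_measure (μ := P.prod P) (f := fun p => (A p.1, B p.2))
    hf.aestronglyMeasurable hm.aemeasurable
  rw [map_prodMk_eq_map_prod hA hB h] at h1
  exact h1.symm.trans h2

lemma integral_eq_integral_integral_of_indepFun {F : Type*} [NormedAddCommGroup F]
    [NormedSpace ℝ F] (hA : Measurable A) (hB : Measurable B) (h : IndepFun A B P)
    {f : S × U → F} (hf : StronglyMeasurable f)
    (hi : Integrable (fun p : Ω × Ω => f (A p.1, B p.2)) (P.prod P)) :
    ∫ ω, f (A ω, B ω) ∂P = ∫ ω, ∫ ω', f (A ω, B ω') ∂P ∂P := by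
  have hm : Measurable fun p : Ω × Ω => (A p.1, B p.2) := by fun_prop
  rw [← integral_prod _ hi, ← integral_map (φ := fun p : Ω × Ω => (A p.1, B p.2)) hm.aemeasurable
      hf.aestronglyMeasurable, ← map_prodMk_eq_map_prod hA hB h,
    integral_map (by fun_prop) hf.aestronglyMeasurable]

end Transfer

/-! ### From deterministic to random parameters. -/

section RandomParameter

variable {d : ℕ} {φ : Vec d → ℝ} {Ω : Type*}

lemma sampleSigma_le_comap (X : ℕ → Ω → Vec d) (n : ℕ) :
    sampleSigma X n ≤ MeasurableSpace.comap (fun ω i => X i ω) inferInstance := by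
  refine iSup₂_le fun i _ => ?_
  rw [show X i = (fun x : ℕ → Vec d => x i) ∘ fun ω i => X i ω from rfl,
    ← MeasurableSpace.comap_comp]
  exact MeasurableSpace.comap_mono (measurable_pi_apply i).comap_le

/-- Parameters computed from a sample are measurable functions of that sample. -/
lemma exists_measurable_factor {X : ℕ → Ω → Vec d} {θ : ℕ → Ω → Vec d}
    (hθ : ∀ n, Measurable[sampleSigma X n] (θ n)) :
    ∃ T : (ℕ → Vec d) → ℕ → Vec d, Measurable T ∧
      (fun ω k => θ k ω) = T ∘ fun ω i => X i ω := by
  -- Doob–Dynkin factorization through the whole sample; one map for all `k` gives joint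
  -- independence of the parameter sequence from the other sample.
  have h (k : ℕ) := ((hθ k).mono (sampleSigma_le_comap X k) le_rfl).exists_eq_measurable_comp
  choose T hT hT' using h
  exact ⟨fun x k => T k x, measurable_pi_lambda _ hT, funext fun ω => funext fun k =>
    congrFun (hT' k) ω⟩

lemma measurable_estimator_uncurry (hφ : Measurable φ) (m : ℕ) :
    Measurable fun p : Vec d × (ℕ → Vec d) => estimator φ p.2 m p.1 := by
  unfold estimator
  refine (Finset.measurable_fun_sum _ fun i _ => ?_).const_mul _
  exact (measurable_shifted_uncurry hφ).comp
    (measurable_fst.prodMk ((measurable_pi_apply i).comp measurable_snd))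

variable [MeasurableSpace Ω] {P : Measure Ω} [IsProbabilityMeasure P]

/-- For each frozen parameter the `L¹` norm equals that of `φ`, so integrability requires no moment
of the random parameter. -/
lemma TiltIntegrable.integral_shifted_of_indepFun (h : TiltIntegrable φ) (hφ : Measurable φ)
    {T Y : Ω → Vec d} (hT : Measurable T) (hY : Measurable Y) (hYlaw : P.map Y = gauss d)
    (hind : IndepFun T Y P) :
    Integrable (fun ω => shifted φ (T ω) (Y ω)) P ∧
      ∫ ω, shifted φ (T ω) (Y ω) ∂P = ∫ x, φ x ∂(gauss d) := by
  have hs := measurable_shifted_uncurry hφ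
  have hi : Integrable (fun p : Ω × Ω => shifted φ (T p.1) (Y p.2)) (P.prod P) := by
    have hsm : Measurable fun p : Ω × Ω => shifted φ (T p.1) (Y p.2) :=
      hs.comp (f := fun p : Ω × Ω => (T p.1, Y p.2)) (by fun_prop)
    rw [integrable_prod_iff hsm.aestronglyMeasurable]
    constructor
    · refine ae_of_all _ fun ω => ?_
      have := h.integrable_shifted hφ (T ω)
      rw [← hYlaw, integrable_map_measure (measurable_shifted hφ _).aestronglyMeasurable
        hY.aemeasurable] at this
      exact this
    · have h1 (ω : Ω) : ∫ ω', ‖shifted φ (T ω) (Y ω')‖ ∂P = ∫ x, |φ x| ∂(gauss d) := by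
        rw [← integral_abs_shifted φ (T ω), ← hYlaw, integral_map hY.aemeasurable
          (measurable_shifted hφ _).abs.aestronglyMeasurable]
        rfl
      simp_rw [h1]
      exact integrable_const _
  refine ⟨(integrable_iff_of_indepFun hT hY hind hs.stronglyMeasurable).2 hi, ?_⟩
  rw [integral_eq_integral_integral_of_indepFun hT hY hind hs.stronglyMeasurable hi]
  have h1 (ω : Ω) : ∫ ω', shifted φ (T ω) (Y ω') ∂P = ∫ x, φ x ∂(gauss d) := by
    rw [← integral_shifted φ (T ω), ← hYlaw, integral_map hY.aemeasurable
      (measurable_shifted hφ _).aestronglyMeasurable]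
  simp [h1]

variable {Y : ℕ → Ω → Vec d} {T : ℕ → Ω → Vec d}

lemma TiltIntegrable.integral_estimator_of_indepFun (h : TiltIntegrable φ) (hφ : Measurable φ)
    (hYm : ∀ i, Measurable (Y i)) (hYlaw : ∀ i, P.map (Y i) = gauss d)
    (hT : ∀ k, Measurable (T k)) (hind : IndepFun (fun ω k => T k ω) (fun ω i => Y i ω) P)
    {m : ℕ} (hm : 1 ≤ m) (k : ℕ) :
    Integrable (fun ω => estimator φ (fun i => Y i ω) m (T k ω)) P ∧
      ∫ ω, estimator φ (fun i => Y i ω) m (T k ω) ∂P = ∫ x, φ x ∂(gauss d) := by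
  have hterm (i : ℕ) := h.integral_shifted_of_indepFun hφ (hT k) (hYm i) (hYlaw i)
    (hind.comp (measurable_pi_apply k) (measurable_pi_apply i))
  unfold estimator
  refine ⟨(integrable_finsetSum _ fun i _ => (hterm i).1).const_mul _, ?_⟩
  have hm' : (m : ℝ) ≠ 0 := by positivity
  rw [integral_const_mul, integral_finsetSum _ fun i _ => (hterm i).1,
    Finset.sum_congr rfl fun i _ => (hterm i).2, Finset.sum_const, Finset.card_range, nsmul_eq_mul]
  field_simp

lemma TiltIntegrable.ae_tendsto_estimator_of_indepFun (h : TiltIntegrable φ) (hφ : Measurable φ)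
    (hYm : ∀ i, Measurable (Y i)) (hYlaw : ∀ i, P.map (Y i) = gauss d) (hY : iIndepFun Y P)
    (hT : ∀ k, Measurable (T k)) (hind : IndepFun (fun ω k => T k ω) (fun ω i => Y i ω) P)
    {θs : Vec d} (hlim : ∀ᵐ ω ∂P, Tendsto (fun m => T m ω) atTop (𝓝 θs)) :
    ∀ᵐ ω ∂P, Tendsto (fun m => estimator φ (fun i => Y i ω) m (T m ω)) atTop
      (𝓝 (∫ x, φ x ∂(gauss d))) := by
  have hs : MeasurableSet {p : (ℕ → Vec d) × (ℕ → Vec d) |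
      Tendsto (fun m => estimator φ p.2 m (p.1 m)) atTop (𝓝 (∫ x, φ x ∂(gauss d)))} :=
    measurableSet_tendsto _ fun m => (measurable_estimator_uncurry hφ m).comp
      (f := fun p : (ℕ → Vec d) × (ℕ → Vec d) => (p.1 m, p.2)) (by fun_prop)
  refine ae_of_ae_ae_of_indepFun (measurable_pi_lambda _ hT) (measurable_pi_lambda _ hYm) hind hs ?_
  filter_upwards [hlim] with ω hω
  -- A convergent frozen sequence is bounded, as the deterministic strong law requires.
  obtain ⟨M, hM⟩ := hω.norm.bddAbove_range
  exact h.ae_tendsto_estimator hφ hYm hYlaw hY fun m => hM ⟨m, rfl⟩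

/-- The inner integral over the second sample converges to the same constant for almost every frozen
parameter sequence. It is bounded by `1`, so the outer integral converges too. -/
lemma TiltIntegrable.tendsto_integral_cexp_of_indepFun (h : TiltIntegrable φ) (hφ : Measurable φ)
    (hYm : ∀ i, Measurable (Y i)) (hYlaw : ∀ i, P.map (Y i) = gauss d) (hY : iIndepFun Y P)
    (hT : ∀ k, Measurable (T k)) (hind : IndepFun (fun ω k => T k ω) (fun ω i => Y i ω) P)
    {θs : Vec d} (hlim : ∀ᵐ ω ∂P, Tendsto (fun m => T m ω) atTop (𝓝 θs)) (t : ℝ) :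
    Tendsto (fun m : ℕ => ∫ ω, Complex.exp (t * (√m * (estimator φ (fun i => Y i ω) m (T m ω)
      - ∫ x, φ x ∂(gauss d)) : ℝ) * Complex.I) ∂P) atTop
      (𝓝 (Complex.exp (-(t : ℂ) ^ 2 * (v φ θs - (∫ x, φ x ∂(gauss d)) ^ 2 : ℝ) / 2))) := by
  generalize hc : ∫ x, φ x ∂(gauss d) = c
  have hYm' : Measurable fun ω i => Y i ω := measurable_pi_lambda _ hYm
  set f : ℕ → Vec d × (ℕ → Vec d) → ℂ := fun m p =>
    Complex.exp (t * (√(m : ℝ) * (estimator φ p.2 m p.1 - c) : ℝ) * Complex.I) with hf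
  have hfm (m : ℕ) : Measurable (f m) := by
    have := measurable_estimator_uncurry hφ m
    fun_prop
  have hfb (m : ℕ) (p : Vec d × (ℕ → Vec d)) : ‖f m p‖ ≤ 1 := by
    simp only [hf, ← Complex.ofReal_mul]
    exact (Complex.norm_exp_ofReal_mul_I _).le
  have hfi (m : ℕ) : Integrable (fun p : Ω × Ω => f m (T m p.1, fun i => Y i p.2)) (P.prod P) := by
    have hm : Measurable fun p : Ω × Ω => f m (T m p.1, fun i => Y i p.2) :=
      (hfm m).comp (((hT m).comp measurable_fst).prodMk (hYm'.comp measurable_snd))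
    exact Integrable.of_bound hm.aestronglyMeasurable 1 (ae_of_all _ fun p => hfb m _)
  have hfub (m : ℕ) : ∫ ω, f m (T m ω, fun i => Y i ω) ∂P
      = ∫ ω, ∫ ω', f m (T m ω, fun i => Y i ω') ∂P ∂P :=
    integral_eq_integral_integral_of_indepFun (hT m) hYm'
      (hind.comp (measurable_pi_apply m) measurable_id) (hfm m).stronglyMeasurable (hfi m)
  have hdom : Tendsto (fun m : ℕ => ∫ ω, ∫ ω', f m (T m ω, fun i => Y i ω') ∂P ∂P) atTop
      (𝓝 (∫ _, Complex.exp (-(t : ℂ) ^ 2 * (v φ θs - c ^ 2 : ℝ) / 2) ∂P)) := by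
    refine tendsto_integral_of_dominated_convergence (fun _ => 1)
      (fun m => (hfi m).integral_prod_left.aestronglyMeasurable) (integrable_const 1)
      (fun m => ae_of_all _ fun ω => ?_) ?_
    · simpa using norm_integral_le_of_norm_le_const
        (ae_of_all P fun ω' => hfb m (T m ω, fun i => Y i ω'))
    · filter_upwards [hlim] with ω hω
      have := h.tendsto_integral_cexp_estimator hφ hYm hYlaw hY hω t
      rwa [hc] at this
  simp_rw [← hfub] at hdom
  rwa [integral_const, probReal_univ, one_smul] at hdom

lemma TiltIntegrable.tendstoInDistribution_estimator (h : TiltIntegrable φ) (hφ : Measurable φ)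
    (hYm : ∀ i, Measurable (Y i)) (hYlaw : ∀ i, P.map (Y i) = gauss d) (hY : iIndepFun Y P)
    (hT : ∀ k, Measurable (T k)) (hind : IndepFun (fun ω k => T k ω) (fun ω i => Y i ω) P)
    {θs : Vec d} (hlim : ∀ᵐ ω ∂P, Tendsto (fun m => T m ω) atTop (𝓝 θs)) :
    TendstoInDistribution (fun (m : ℕ) ω => √(m : ℝ) *
      (estimator φ (fun i => Y i ω) m (T m ω) - ∫ x, φ x ∂(gauss d))) atTop (id : ℝ → ℝ)
      (fun _ => P) (gaussianReal 0 (Real.toNNReal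
        (v φ θs - (∫ x, φ x ∂(gauss d)) ^ 2))) := by
  have hW (m : ℕ) : Measurable fun ω =>
      √(m : ℝ) * (estimator φ (fun i => Y i ω) m (T m ω) - ∫ x, φ x ∂(gauss d)) :=
    (((measurable_estimator_uncurry hφ m).comp
      ((hT m).prodMk (measurable_pi_lambda _ hYm))).sub_const _).const_mul _
  have hvar : 0 ≤ v φ θs - (∫ x, φ x ∂(gauss d)) ^ 2 := by
    rw [← h.variance_shifted hφ θs]; exact variance_nonneg _ _
  refine ⟨fun m => (hW m).aemeasurable, aemeasurable_id, ?_⟩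
  refine ProbabilityMeasure.tendsto_iff_tendsto_charFun.2 fun t => ?_
  have key := h.tendsto_integral_cexp_of_indepFun hφ hYm hYlaw hY hT hind hlim t
  have hchar (m : ℕ) : charFun (P.map fun ω =>
      √(m : ℝ) * (estimator φ (fun i => Y i ω) m (T m ω) - ∫ x, φ x ∂(gauss d))) t
      = ∫ ω, Complex.exp (t * (√m * (estimator φ (fun i => Y i ω) m (T m ω)
        - ∫ x, φ x ∂(gauss d)) : ℝ) * Complex.I) ∂P := by
    rw [charFun_apply_real, integral_map (hW m).aemeasurable (by fun_prop)]
  have hgauss : charFun ((gaussianReal 0 (Real.toNNReal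
      (v φ θs - (∫ x, φ x ∂(gauss d)) ^ 2))).map id) t
      = Complex.exp (-(t : ℂ) ^ 2 * (v φ θs - (∫ x, φ x ∂(gauss d)) ^ 2 : ℝ) / 2) := by
    rw [Measure.map_id, charFun_gaussianReal, Real.coe_toNNReal _ hvar]
    congr 1
    push_cast
    ring
  simp_rw [← hchar, ← hgauss] at key
  exact key

end RandomParameter

end AdaptiveIS

theorem mainTheorem2 {d : ℕ} {Ω : Type*} [MeasurableSpace Ω] (P : Measure Ω)
    [IsProbabilityMeasure P]
    -- the integrand and its integrability and non-degeneracy assumptions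
    (φ : AdaptiveIS.Vec d → ℝ) (hφ : Measurable φ)
    (hint : ∀ θ : AdaptiveIS.Vec d,
      Integrable (fun x => φ x ^ 2 * Real.exp (-⟪θ, x⟫)) (AdaptiveIS.gauss d))
    (hpos : 0 < AdaptiveIS.gauss d {x | φ x ≠ 0})
    -- two independent i.i.d. standard Gaussian samples
    (X Xbar : ℕ → Ω → AdaptiveIS.Vec d)
    (hXm : ∀ i, Measurable (X i)) (hXbarm : ∀ i, Measurable (Xbar i))
    (hXlaw : ∀ i, P.map (X i) = AdaptiveIS.gauss d)
    (hXbarlaw : ∀ i, P.map (Xbar i) = AdaptiveIS.gauss d)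
    (hXindep : iIndepFun X P) (hXbarindep : iIndepFun Xbar P)
    (hindep : IndepFun (fun ω i => X i ω) (fun ω i => Xbar i ω) P)
    -- `θ n` is a minimizer of the empirical criterion, computed from the first `n` points of `X`
    (θ : ℕ → Ω → AdaptiveIS.Vec d)
    (hθm : ∀ n, Measurable[AdaptiveIS.sampleSigma X n] (θ n))
    (hθmin : ∀ n, ∀ᵐ ω ∂P, ∀ t, AdaptiveIS.vEmp φ (fun i => X i ω) n (θ n ω)
      ≤ AdaptiveIS.vEmp φ (fun i => X i ω) n t)
    (n : ℕ → ℕ) (hnmono : Monotone n) (hn : Tendsto n atTop atTop) :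
    -- unbiasedness
    (∀ m, 1 ≤ m →
      Integrable (fun ω => AdaptiveIS.estimator φ (fun i => Xbar i ω) m (θ (n m) ω)) P ∧
      ∫ ω, AdaptiveIS.estimator φ (fun i => Xbar i ω) m (θ (n m) ω) ∂P
        = ∫ x, φ x ∂(AdaptiveIS.gauss d)) ∧
    -- almost sure convergence
    (∀ᵐ ω ∂P, Tendsto (fun m => AdaptiveIS.estimator φ (fun i => Xbar i ω) m (θ (n m) ω)) atTop
      (𝓝 (∫ x, φ x ∂(AdaptiveIS.gauss d)))) ∧
    -- existence and uniqueness of the optimal parameter, and the central limit theorem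
    ∃ θs : AdaptiveIS.Vec d,
      (∀ t, t ≠ θs → AdaptiveIS.v φ θs < AdaptiveIS.v φ t) ∧
      ((∀ᵐ x ∂(volume : Measure (AdaptiveIS.Vec d)), ContinuousAt φ x) →
        (∃ η : ℝ, 0 < η ∧ ∃ V ∈ 𝓝 θs, IsCompact V ∧
          (⨆ t ∈ V, ∫⁻ x, ‖φ (x + t)‖ₑ ^ (2 + η) ∂(AdaptiveIS.gauss d)) < (⊤ : ℝ≥0∞)) →
        MemLp (AdaptiveIS.shifted φ θs) 2 (AdaptiveIS.gauss d) ∧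
        Var[AdaptiveIS.shifted φ θs; AdaptiveIS.gauss d]
          = AdaptiveIS.v φ θs - (∫ x, φ x ∂(AdaptiveIS.gauss d)) ^ 2 ∧
        TendstoInDistribution
          (fun (m : ℕ) ω => √(m : ℝ) *
            (AdaptiveIS.estimator φ (fun i => Xbar i ω) m (θ (n m) ω)
              - ∫ x, φ x ∂(AdaptiveIS.gauss d)))
          atTop (id : ℝ → ℝ) (fun _ => P)
          (gaussianReal 0 (Real.toNNReal
            (AdaptiveIS.v φ θs - (∫ x, φ x ∂(AdaptiveIS.gauss d)) ^ 2)))) := by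
  have h : AdaptiveIS.TiltIntegrable φ := hint
  obtain ⟨θs, hθs⟩ := h.exists_integral_score_eq_zero hφ hpos
  obtain ⟨T, hT, hθT⟩ := AdaptiveIS.exists_measurable_factor hθm
  have hXpi : Measurable fun ω i => X i ω := measurable_pi_lambda _ hXm
  have hθpi : Measurable fun ω k => θ k ω := hθT ▸ hT.comp hXpi
  have hind : IndepFun (fun ω k => θ k ω) (fun ω i => Xbar i ω) P :=
    hθT ▸ hindep.comp hT measurable_id
  have hθmeas (m : ℕ) : Measurable (θ (n m)) := (measurable_pi_apply (n m)).comp hθpi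
  -- Reindexing along `n` is a measurable map of the full parameter sequence, so independence
  -- persists.
  have hindn : IndepFun (fun ω m => θ (n m) ω) (fun ω i => Xbar i ω) P :=
    hind.comp (φ := fun (a : ℕ → AdaptiveIS.Vec d) m => a (n m))
      (measurable_pi_lambda _ fun m => measurable_pi_apply (n m)) measurable_id
  have hlim : ∀ᵐ ω ∂P, Tendsto (fun m => θ (n m) ω) atTop (𝓝 θs) := by
    filter_upwards [h.tendsto_argmin hφ hpos hθs hXm hXlaw hXindep hθmin] with ω hω
    exact hω.comp hn
  exact ⟨fun m hm => h.integral_estimator_of_indepFun hφ hXbarm hXbarlaw hθmeas hindn hm m,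
    h.ae_tendsto_estimator_of_indepFun hφ hXbarm hXbarlaw hXbarindep hθmeas hindn hlim,
    θs, fun t ht => h.v_lt hφ hpos hθs ht, fun _ _ => ⟨h.memLp_shifted hφ θs,
      h.variance_shifted hφ θs,
      h.tendstoInDistribution_estimator hφ hXbarm hXbarlaw hXbarindep hθmeas hindn hlim⟩⟩
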